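/- Let $m>0$ be real and $n\in\mathbb N$. For $y\in\mathbb Z^n$, $1\le i\le n$ and $e\in\{1,-1\}$ let $y^{i,i+e}\in\mathbb Z^n$ be $y$ with its $i$-th coordinate $y_i$ replaced by $y_i+e$. Let $(Y(t),\tilde Y(t))_{t\ge 0}$ be the coupling of $n$ particles of the symmetric inclusion process $\mathrm{SIP}(m)$ on $\mathbb Z$ (positions $Y_1(t),\dots,Y_n(t)$) and $n$ independent random walkers on $\mathbb Z$ which jump to each of their two neighbours at rate $m/2$ (positions $\tilde Y_1(t),\dots,\tilde Y_n(t)$), in which random walk jumps are made jointly and inclusion jumps are made by the inclusion particles only; that is, the continuous-time Markov process on $\mathbb Z^n\times\mathbb Z^n$ with the (bounded) generator $$\mathcal L f(y,\tilde y)=\sum_{e=\pm1}\sum_{i=1}^n\frac m2\left[f(y^{i,i+e},\tilde y^{i,i+e})-f(y,\tilde y)\right]+\sum_{e=\pm1}\sum_{i=1}^n\sum_{k=1}^n I(y_k=y_i+e)\left[f(y^{i,i+e},\tilde y)-f(y,\tilde y)\right].$$ Suppose that $Y(0)=\tilde Y(0)$ almost surely. Then, for every $1\le i\le n$, $$\lim_{t\to\infty}\frac{|Y_i(t)-\tilde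 Y_i(t)|^2}{t}=0\quad\text{in probability}.$$ -/

import Mathlib

open MeasureTheory ProbabilityTheory Filter Topology
open scoped NNReal

namespace InclusionProcess

/-- Positions of `n` labelled particles on `ℤ`. -/
abbrev Conf (n : ℕ) : Type := Fin n → ℤ

/-- The configuration `y^{i,i+e}`: particle `i` is translated by `e`, the others stay put. -/
def move {n : ℕ} (y : Conf n) (i : Fin n) (e : ℤ) : Conf n :=
  Function.update y i (y i + e)

/-- The generator of the coupling of `n` `SIP(m)` particles (first component) and `n`
random walkers (second component), acting on functions of the two configurations.
Random walk jumps, at rate `m / 2` in each direction, are made jointly by both particles of the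
same label; an inclusion jump of particle `i` towards a neighbouring particle `k`, at rate `1`,
is made in the first component only. -/
noncomputable def gen {n : ℕ} (m : ℝ) (f : Conf n × Conf n → ℝ) (p : Conf n × Conf n) : ℝ :=
  (∑ e ∈ ({1, -1} : Finset ℤ), ∑ i : Fin n,
      m / 2 * (f (move p.1 i e, move p.2 i e) - f p)) +
  ∑ e ∈ ({1, -1} : Finset ℤ), ∑ i : Fin n, ∑ k : Fin n,
      (if p.1 k = p.1 i + e then 1 else 0) * (f (move p.1 i e, p.2) - f p)

theorem gen_add {n : ℕ} (m : ℝ) (f g : Conf n × Conf n → ℝ) (p : Conf n × Conf n) :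
    gen m (fun q => f q + g q) p = gen m f p + gen m g p := by
  unfold gen
  rw [add_add_add_comm]
  congr 1
  · simp only [← Finset.sum_add_distrib]
    refine Finset.sum_congr rfl fun e _ => Finset.sum_congr rfl fun i _ => ?_
    ring
  · simp only [← Finset.sum_add_distrib]
    refine Finset.sum_congr rfl fun e _ => Finset.sum_congr rfl fun i _ =>
      Finset.sum_congr rfl fun k _ => ?_
    ring

theorem gen_smul {n : ℕ} (m c : ℝ) (f : Conf n × Conf n → ℝ) (p : Conf n × Conf n) :
    gen m (fun q => c * f q) p = c * gen m f p := by
  unfold gen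
  rw [mul_add]
  simp only [Finset.mul_sum]
  congr 1
  · refine Finset.sum_congr rfl fun e _ => Finset.sum_congr rfl fun i _ => ?_
    ring
  · refine Finset.sum_congr rfl fun e _ => Finset.sum_congr rfl fun i _ =>
      Finset.sum_congr rfl fun k _ => ?_
    ring

/-- The total jump rate is bounded, so the generator is bounded on bounded functions. -/
theorem abs_gen_le {n : ℕ} (m C : ℝ) (f : Conf n × Conf n → ℝ) (hf : ∀ q, |f q| ≤ C)
    (p : Conf n × Conf n) : |gen m f p| ≤ (2 * n * |m| + 4 * n ^ 2) * C := by
  have hd : ∀ q r, |f q - f r| ≤ 2 * C := fun q r =>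
    (abs_sub _ _).trans (by linarith [hf q, hf r])
  have hC : 0 ≤ C := (abs_nonneg _).trans (hf p)
  have h1 : |∑ e ∈ ({1, -1} : Finset ℤ), ∑ i : Fin n,
      m / 2 * (f (move p.1 i e, move p.2 i e) - f p)| ≤
      ∑ e ∈ ({1, -1} : Finset ℤ), ∑ i : Fin n, |m| / 2 * (2 * C) := by
    refine (Finset.abs_sum_le_sum_abs _ _).trans (Finset.sum_le_sum fun e _ => ?_)
    refine (Finset.abs_sum_le_sum_abs _ _).trans (Finset.sum_le_sum fun i _ => ?_)
    rw [abs_mul, abs_div, abs_two]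
    exact mul_le_mul_of_nonneg_left (hd _ _) (by positivity)
  have h2 : |∑ e ∈ ({1, -1} : Finset ℤ), ∑ i : Fin n, ∑ k : Fin n,
      (if p.1 k = p.1 i + e then 1 else 0) * (f (move p.1 i e, p.2) - f p)| ≤
      ∑ e ∈ ({1, -1} : Finset ℤ), ∑ i : Fin n, ∑ k : Fin n, 2 * C := by
    refine (Finset.abs_sum_le_sum_abs _ _).trans (Finset.sum_le_sum fun e _ => ?_)
    refine (Finset.abs_sum_le_sum_abs _ _).trans (Finset.sum_le_sum fun i _ => ?_)
    refine (Finset.abs_sum_le_sum_abs _ _).trans (Finset.sum_le_sum fun k _ => ?_)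
    split_ifs
    · simpa using hd _ _
    · simpa using hC
  refine (abs_add_le _ _).trans ((add_le_add h1 h2).trans (le_of_eq ?_))
  rw [Finset.sum_pair (by decide), Finset.sum_pair (by decide)]
  simp only [Finset.sum_const, Finset.card_univ, Fintype.card_fin, nsmul_eq_mul]
  ring

/-- The Banach space `ℓ^∞` of bounded real functions of the two configurations. -/
abbrev BddFun (n : ℕ) : Type := lp (fun _ : Conf n × Conf n => ℝ) ⊤

/-- The generator as a bounded operator on the bounded functions. -/
noncomputable def genL (n : ℕ) (m : ℝ) : BddFun n →L[ℝ] BddFun n :=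
  LinearMap.mkContinuous
    { toFun := fun f => ⟨gen m f, memℓp_infty ⟨(2 * n * |m| + 4 * n ^ 2) * ‖f‖, by
        rintro _ ⟨p, rfl⟩
        exact abs_gen_le m ‖f‖ f (fun q => lp.norm_apply_le_norm ENNReal.top_ne_zero f q) p⟩⟩
      map_add' := fun f g => by ext p; exact gen_add m f g p
      map_smul' := fun c f => by ext p; exact gen_smul m c f p }
    (2 * n * |m| + 4 * n ^ 2)
    (fun f => lp.norm_le_of_forall_le (by positivity) fun p =>
      abs_gen_le m ‖f‖ f (fun q => lp.norm_apply_le_norm ENNReal.top_ne_zero f q) p)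

/-- The Markov semigroup `S_t = exp (t L)` with generator `L`, on bounded functions. -/
noncomputable def semigroup (n : ℕ) (m : ℝ) (t : ℝ≥0) : BddFun n →L[ℝ] BddFun n :=
  NormedSpace.exp ((t : ℝ) • genL n m)

/-- `(Y(t), Y'(t))`, `t ≥ 0`, is a version of the coupling of `n` `SIP(m)` particles and `n`
independent random walkers: it is a Markov process, relative to its own past, whose
transition semigroup is the one generated by `gen m`. -/
structure IsCoupling {Ω : Type*} [MeasurableSpace Ω] (μ : Measure Ω) {n : ℕ} (m : ℝ)
    (Y Y' : ℝ≥0 → Ω → Conf n) : Prop where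
  measurable_left : ∀ t, Measurable (Y t)
  measurable_right : ∀ t, Measurable (Y' t)
  markov : ∀ (s t : ℝ≥0) (f : BddFun n),
    μ[fun ω => f (Y (s + t) ω, Y' (s + t) ω) |
        ⨆ r ≤ s, MeasurableSpace.comap (fun ω => (Y r ω, Y' r ω)) inferInstance]
      =ᵐ[μ] fun ω => semigroup n m t f (Y s ω, Y' s ω)

end InclusionProcess

namespace InclusionProcess

/-- `q` is reached from `p` by one jump of the coupling. -/
def Jump {n : ℕ} (p q : Conf n × Conf n) : Prop :=
  (∃ i : Fin n, ∃ e ∈ ({1, -1} : Finset ℤ), q = (move p.1 i e, move p.2 i e)) ∨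
    ∃ i k : Fin n, ∃ e ∈ ({1, -1} : Finset ℤ), p.1 k = p.1 i + e ∧ q = (move p.1 i e, p.2)

theorem gen_le_gen {n : ℕ} {m : ℝ} (hm : 0 ≤ m) {f g : Conf n × Conf n → ℝ} {p : Conf n × Conf n}
    (h : ∀ q, Jump p q → f q - f p ≤ g q - g p) : gen m f p ≤ gen m g p := by
  unfold gen
  refine add_le_add ?_ ?_
  · refine Finset.sum_le_sum fun e he => Finset.sum_le_sum fun i _ => ?_
    exact mul_le_mul_of_nonneg_left (h _ (Or.inl ⟨i, e, he, rfl⟩)) (by positivity)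
  · refine Finset.sum_le_sum fun e he => Finset.sum_le_sum fun i _ =>
      Finset.sum_le_sum fun k _ => ?_
    split_ifs with hk
    · simpa using h _ (Or.inr ⟨i, k, e, he, hk, rfl⟩)
    · simp

/-- An upper bound of the total jump rate of `n` particles. -/
noncomputable def rate (n : ℕ) (m : ℝ) : ℝ := n * m + 2 * n ^ 2

theorem rate_nonneg {n : ℕ} {m : ℝ} (hm : 0 ≤ m) : 0 ≤ rate n m := by
  unfold rate; positivity

theorem gen_le_rate_mul {n : ℕ} {m : ℝ} (hm : 0 ≤ m) {f : Conf n × Conf n → ℝ}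
    {p : Conf n × Conf n} {D : ℝ} (hD : 0 ≤ D) (h : ∀ q, Jump p q → f q - f p ≤ D) :
    gen m f p ≤ rate n m * D := by
  have h1 : ∑ e ∈ ({1, -1} : Finset ℤ), ∑ i : Fin n,
      m / 2 * (f (move p.1 i e, move p.2 i e) - f p) ≤
      ∑ e ∈ ({1, -1} : Finset ℤ), ∑ i : Fin n, m / 2 * D :=
    Finset.sum_le_sum fun e he => Finset.sum_le_sum fun i _ =>
      mul_le_mul_of_nonneg_left (h _ (Or.inl ⟨i, e, he, rfl⟩)) (by positivity)
  have h2 : ∑ e ∈ ({1, -1} : Finset ℤ), ∑ i : Fin n, ∑ k : Fin n,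
      (if p.1 k = p.1 i + e then 1 else 0) * (f (move p.1 i e, p.2) - f p) ≤
      ∑ e ∈ ({1, -1} : Finset ℤ), ∑ i : Fin n, ∑ k : Fin n, D := by
    refine Finset.sum_le_sum fun e he => Finset.sum_le_sum fun i _ =>
      Finset.sum_le_sum fun k _ => ?_
    split_ifs with hk
    · simpa using h _ (Or.inr ⟨i, k, e, he, hk, rfl⟩)
    · simpa using hD
  refine (add_le_add h1 h2).trans (le_of_eq ?_)
  rw [Finset.sum_pair (by decide), Finset.sum_pair (by decide)]
  simp only [Finset.sum_const, Finset.card_univ, Fintype.card_fin, nsmul_eq_mul, rate]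
  ring

theorem gen_neg {n : ℕ} (m : ℝ) (f : Conf n × Conf n → ℝ) (p : Conf n × Conf n) :
    gen m (fun q => -f q) p = -gen m f p := by
  simpa using gen_smul m (-1) f p

theorem gen_sub {n : ℕ} (m : ℝ) (f g : Conf n × Conf n → ℝ) (p : Conf n × Conf n) :
    gen m (fun q => f q - g q) p = gen m f p - gen m g p := by
  simpa [gen_neg, sub_eq_add_neg] using gen_add m f (fun q => -g q) p

theorem gen_const {n : ℕ} (m c : ℝ) (p : Conf n × Conf n) : gen m (fun _ => c) p = 0 := by
  simp [gen]

theorem gen_sum {n : ℕ} {ι : Type*} (m : ℝ) (s : Finset ι) (f : ι → Conf n × Conf n → ℝ)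
    (p : Conf n × Conf n) : gen m (fun q => ∑ j ∈ s, f j q) p = ∑ j ∈ s, gen m (f j) p := by
  classical
  induction s using Finset.induction_on with
  | empty => simp [gen_const]
  | insert a s ha ih => simp only [Finset.sum_insert ha, gen_add, ih]

theorem neg_rate_mul_le_gen {n : ℕ} {m : ℝ} (hm : 0 ≤ m) {f : Conf n × Conf n → ℝ}
    {p : Conf n × Conf n} {D : ℝ} (hD : 0 ≤ D) (h : ∀ q, Jump p q → -D ≤ f q - f p) :
    -(rate n m * D) ≤ gen m f p := by
  have := gen_le_rate_mul (f := fun q => -f q) hm hD fun q hq => by linarith [h q hq]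
  rw [gen_neg] at this
  linarith

theorem abs_gen_le_rate_mul {n : ℕ} {m : ℝ} (hm : 0 ≤ m) {f : Conf n × Conf n → ℝ}
    {p : Conf n × Conf n} {D : ℝ} (hD : 0 ≤ D) (h : ∀ q, Jump p q → |f q - f p| ≤ D) :
    |gen m f p| ≤ rate n m * D :=
  abs_le.2 ⟨neg_rate_mul_le_gen hm hD fun q hq => (abs_le.1 (h q hq)).1,
    gen_le_rate_mul hm hD fun q hq => (abs_le.1 (h q hq)).2⟩

section Exponential

variable {E : Type*} [NormedAddCommGroup E] [NormedSpace ℝ E] [CompleteSpace E]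

theorem hasSum_exp_smul_apply (B : E →L[ℝ] E) (ψ : E →L[ℝ] ℝ) (t : ℝ) (f : E) :
    HasSum (fun k : ℕ => (k.factorial : ℝ)⁻¹ * (t ^ k * ψ ((B ^ k) f)))
      (ψ (NormedSpace.exp (t • B) f)) := by
  have hs := NormedSpace.exp_series_hasSum_exp' (𝕂 := ℝ) (t • B)
  have hs' := hs.mapL (ψ.comp (ContinuousLinearMap.apply ℝ E f))
  convert hs' using 1
  · funext k
    simp [smul_pow]
  · rfl

theorem exp_smul_eq_smul_exp_add (A : E →L[ℝ] E) (r t : ℝ) :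
    NormedSpace.exp (t • A) = Real.exp (-(t * r)) • NormedSpace.exp (t • (A + r • 1)) := by
  let : NormedAlgebra ℚ (E →L[ℝ] E) := NormedAlgebra.restrictScalars ℚ ℝ _
  have hdec : t • A = t • (A + r • (1 : E →L[ℝ] E)) + algebraMap ℝ _ (-(t * r)) := by
    rw [Algebra.algebraMap_eq_smul_one, smul_add, smul_smul, add_assoc, ← add_smul]
    simp
  have hcomm : Commute (t • (A + r • (1 : E →L[ℝ] E))) (algebraMap ℝ _ (-(t * r))) :=
    (Algebra.commutes _ _).symm
  rw [hdec, NormedSpace.exp_add_of_commute hcomm, ← NormedSpace.algebraMap_exp_comm,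
    ← Real.exp_eq_exp_ℝ, ← Algebra.commutes, Algebra.algebraMap_eq_smul_one, smul_mul_assoc,
    one_mul]

theorem hasDerivAt_exp_smul_apply (A : E →L[ℝ] E) (ψ : E →L[ℝ] ℝ) (f : E) (u : ℝ) :
    HasDerivAt (fun u : ℝ => ψ (NormedSpace.exp (u • A) f))
      (ψ (NormedSpace.exp (u • A) (A f))) u :=
  ((ψ.comp (ContinuousLinearMap.apply ℝ E f)).hasFDerivAt.comp_hasDerivAt u
    (hasDerivAt_exp_smul_const (𝕂 := ℝ) A u))

end Exponential

theorem exp_zero_smul_apply {E : Type*} [NormedAddCommGroup E] [NormedSpace ℝ E] (A : E →L[ℝ] E)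
    (f : E) : NormedSpace.exp ((0 : ℝ) • A) f = f := by
  rw [zero_smul, NormedSpace.exp_zero]; rfl

/-- Evaluation at a point, as a functional on the bounded functions. -/
noncomputable def evalAt {n : ℕ} (p : Conf n × Conf n) : BddFun n →L[ℝ] ℝ :=
  lp.evalCLM ℝ (fun _ : Conf n × Conf n => ℝ) ⊤ p

theorem evalAt_apply {n : ℕ} (p : Conf n × Conf n) (f : BddFun n) : evalAt p f = f p := rfl

theorem exp_smul_apply_nonneg {n : ℕ} {B : BddFun n →L[ℝ] BddFun n}
    (hB : ∀ f : BddFun n, (∀ p, 0 ≤ f p) → ∀ p, 0 ≤ B f p) {t : ℝ} (ht : 0 ≤ t)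
    {f : BddFun n} (hf : ∀ p, 0 ≤ f p) (p : Conf n × Conf n) :
    0 ≤ NormedSpace.exp (t • B) f p := by
  have hpow : ∀ (k : ℕ) (p), 0 ≤ (B ^ k) f p := by
    intro k
    induction k with
    | zero => simpa using hf
    | succ k ih => rw [pow_succ']; exact hB _ ih
  refine (hasSum_exp_smul_apply B (evalAt p) t f).nonneg fun k => ?_
  have := hpow k p
  rw [evalAt_apply]
  positivity

theorem semigroup_nonneg {n : ℕ} {m : ℝ} (hm : 0 ≤ m) (t : ℝ≥0) {f : BddFun n}
    (hf : ∀ p, 0 ≤ f p) (p : Conf n × Conf n) : 0 ≤ semigroup n m t f p := by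
  have hB : ∀ f : BddFun n, (∀ p, 0 ≤ f p) →
      ∀ p, 0 ≤ (genL n m + rate n m • (1 : BddFun n →L[ℝ] BddFun n)) f p := by
    intro f hf p
    have h : (genL n m + rate n m • (1 : BddFun n →L[ℝ] BddFun n)) f p =
      gen m f p + rate n m * f p := rfl
    have := neg_rate_mul_le_gen (f := f) (p := p) hm (hf p) fun q _ => by linarith [hf q]
    linarith
  have h := exp_smul_apply_nonneg hB t.2 hf p
  rw [semigroup, exp_smul_eq_smul_exp_add _ (rate n m)]
  exact mul_nonneg (Real.exp_pos _).le h

theorem semigroup_le_add {n : ℕ} {m : ℝ} (hm : 0 ≤ m) {f : BddFun n} {K : ℝ}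
    (hf : ∀ p, gen m f p ≤ K) (t : ℝ≥0) (p : Conf n × Conf n) :
    semigroup n m t f p ≤ f p + K * t := by
  let one : BddFun n := ⟨fun _ => 1, memℓp_infty ⟨1, by rintro _ ⟨p, rfl⟩; simp⟩⟩
  have hd : ∀ (g : BddFun n) (u : ℝ), HasDerivAt
      (fun u : ℝ => NormedSpace.exp (u • genL n m) g p)
      (NormedSpace.exp (u • genL n m) (genL n m g) p) u :=
    fun g u => hasDerivAt_exp_smul_apply (genL n m) (evalAt p) g u
  have h0 : ∀ g : BddFun n, NormedSpace.exp ((0 : ℝ) • genL n m) g p = g p := by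
    intro g; rw [exp_zero_smul_apply]
  have hone : ∀ u : ℝ, NormedSpace.exp (u • genL n m) one p = 1 := by
    have hz : genL n m one = 0 := by
      ext q; exact gen_const m 1 q
    intro u
    have : ∀ u, deriv (fun u : ℝ => NormedSpace.exp (u • genL n m) one p) u = 0 := by
      intro u
      rw [(hd one u).deriv, hz]; simp
    rw [is_const_of_deriv_eq_zero (fun u => (hd one u).differentiableAt) this u 0, h0]
  have hder : ∀ u : ℝ, HasDerivAt (fun u : ℝ => NormedSpace.exp (u • genL n m) f p - K * u)
      (NormedSpace.exp (u • genL n m) (genL n m f) p - K) u := by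
    intro u
    have := (hd f u).sub ((hasDerivAt_id u).const_mul K)
    rw [mul_one] at this
    exact this
  have hle : ∀ u : ℝ, 0 ≤ u → NormedSpace.exp (u • genL n m) (genL n m f) p ≤ K := by
    intro u hu
    have := semigroup_nonneg hm ⟨u, hu⟩ (f := K • one - genL n m f)
      (fun q => by
        have : (K • one - genL n m f : BddFun n) q = K * 1 - gen m f q := rfl
        rw [this]; linarith [hf q]) p
    rw [map_sub, map_smul] at this
    have h2 : (K • semigroup n m ⟨u, hu⟩ one - semigroup n m ⟨u, hu⟩ (genL n m f) : BddFun n) p =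
      K * NormedSpace.exp (u • genL n m) one p -
        NormedSpace.exp (u • genL n m) (genL n m f) p := rfl
    rw [h2, hone] at this
    linarith
  have hanti := antitoneOn_of_deriv_nonpos (convex_Ici (0 : ℝ))
    (fun u _ => (hder u).continuousAt.continuousWithinAt)
    (fun u _ => (hder u).differentiableAt.differentiableWithinAt)
    (fun u hu => by
      rw [(hder u).deriv]
      rw [interior_Ici] at hu
      linarith [hle u (le_of_lt hu)])
  have := hanti (Set.mem_Ici.2 le_rfl) (Set.mem_Ici.2 t.2) t.2
  simp only [h0] at this
  simp only [semigroup]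
  simp only [NNReal.val_eq_coe] at this
  linarith

/-- Comparison principle: a nonnegative function whose generator is bounded above dominates the
semigroup applied to any bounded function below it, up to a linear term. -/
theorem semigroup_le_of_gen_le {n : ℕ} {m : ℝ} (hm : 0 ≤ m) {F : Conf n × Conf n → ℝ} {K : ℝ}
    (hK : 0 ≤ K) (hF0 : ∀ q, 0 ≤ F q) (hF : ∀ q, gen m F q ≤ K) {g : BddFun n}
    (hg : ∀ q, g q ≤ F q) (t : ℝ≥0) (p : Conf n × Conf n) :
    semigroup n m t g p ≤ F p + K * t := by
  set R : ℝ := ‖g‖ with hR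
  have hgR : ∀ q, g q ≤ R := fun q =>
    (le_abs_self _).trans (lp.norm_apply_le_norm ENNReal.top_ne_zero g q)
  let f : BddFun n := ⟨fun q => min (F q) R, memℓp_infty ⟨R, by
    rintro _ ⟨q, rfl⟩
    have : 0 ≤ min (F q) R := le_min (hF0 q) (norm_nonneg _)
    change |min (F q) R| ≤ R
    rw [abs_of_nonneg this]
    exact min_le_right _ _⟩⟩
  have hfq : ∀ q, f q = min (F q) R := fun _ => rfl
  have hf : ∀ q, gen m f q ≤ K := by
    intro q
    rcases le_total (F q) R with h | h
    · refine (gen_le_gen hm fun r _ => ?_).trans (hF q)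
      rw [hfq, hfq, min_eq_left h]
      linarith [min_le_left (F r) R]
    · refine (gen_le_rate_mul hm le_rfl fun r _ => ?_).trans (by simpa using hK)
      rw [hfq, hfq, min_eq_right h]
      linarith [min_le_right (F r) R]
  have h1 := semigroup_le_add hm hf t p
  have h2 := semigroup_nonneg hm t (f := f - g) (fun q => by
    have : (f - g : BddFun n) q = f q - g q := rfl
    rw [this, hfq]
    linarith [le_min (hg q) (hgR q)]) p
  rw [map_sub] at h2
  have h3 : (semigroup n m t f - semigroup n m t g : BddFun n) p =
    semigroup n m t f p - semigroup n m t g p := rfl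
  rw [h3] at h2
  have : f p ≤ F p := min_le_left _ _
  linarith

/-- The generator of the symmetric inclusion process with labelled particles. -/
noncomputable def sipGen {n : ℕ} (m : ℝ) (h : Conf n → ℝ) (y : Conf n) : ℝ :=
  gen m (fun q => h q.1) (y, y)

theorem sipGen_eq {n : ℕ} (m : ℝ) (h : Conf n → ℝ) (y : Conf n) :
    sipGen m h y = (∑ e ∈ ({1, -1} : Finset ℤ), ∑ i : Fin n, m / 2 * (h (move y i e) - h y)) +
      ∑ e ∈ ({1, -1} : Finset ℤ), ∑ i : Fin n, ∑ k : Fin n,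
        (if y k = y i + e then 1 else 0) * (h (move y i e) - h y) := rfl

theorem move_apply_self {n : ℕ} (y : Conf n) (i : Fin n) (e : ℤ) : move y i e i = y i + e := by
  simp [move]

theorem move_apply_of_ne {n : ℕ} (y : Conf n) {i j : Fin n} (h : j ≠ i) (e : ℤ) :
    move y i e j = y j := by
  simp [move, h]

theorem move_apply {n : ℕ} (y : Conf n) (i j : Fin n) (e : ℤ) :
    move y i e j = if j = i then y i + e else y j := by
  split_ifs with h
  · rw [h, move_apply_self]
  · rw [move_apply_of_ne y h]

theorem move_comp {k n : ℕ} (y : Conf n) (σ : Fin k ↪ Fin n) (j : Fin k) (e : ℤ) :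
    move y (σ j) e ∘ σ = move (y ∘ σ) j e := by
  funext l
  simp [move_apply]

theorem move_comp_of_notMem {k n : ℕ} (y : Conf n) (σ : Fin k ↪ Fin n) {i : Fin n}
    (hi : i ∉ Set.range σ) (e : ℤ) : move y i e ∘ σ = y ∘ σ := by
  funext l
  exact move_apply_of_ne y (fun h => hi ⟨l, h⟩) e

/-- The embedding obtained from `σ` by exchanging the values `i` and `k`. -/
def swapEquiv {k n : ℕ} (i j : Fin n) : (Fin k ↪ Fin n) ≃ (Fin k ↪ Fin n) :=
  Equiv.embeddingCongr (Equiv.refl _) (Equiv.swap i j)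

theorem swapEquiv_apply {k n : ℕ} (i j : Fin n) (σ : Fin k ↪ Fin n) (l : Fin k) :
    swapEquiv i j σ l = Equiv.swap i j (σ l) := rfl

theorem mem_range_swapEquiv {k n : ℕ} (i j a : Fin n) (σ : Fin k ↪ Fin n) :
    a ∈ Set.range (swapEquiv i j σ) ↔ Equiv.swap i j a ∈ Set.range σ := by
  constructor
  · rintro ⟨l, rfl⟩
    exact ⟨l, by simp [swapEquiv_apply]⟩
  · rintro ⟨l, hl⟩
    exact ⟨l, by simp [swapEquiv_apply, hl]⟩

theorem comp_swapEquiv {k n : ℕ} (y : Conf n) {i j : Fin n} {e : ℤ} (he : y j = y i + e)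
    (σ : Fin k ↪ Fin n) (hj : j ∉ Set.range σ) : y ∘ swapEquiv i j σ = move y i e ∘ σ := by
  funext l
  have hl : σ l ≠ j := fun h => hj ⟨l, h⟩
  by_cases h : σ l = i
  · simp [swapEquiv_apply, h, move_apply_self, he]
  · simp [swapEquiv_apply, Equiv.swap_apply_of_ne_of_ne h hl, move_apply_of_ne y h]

theorem swapEquiv_swapEquiv {k n : ℕ} (i j : Fin n) (σ : Fin k ↪ Fin n) :
    swapEquiv j i (swapEquiv i j σ) = σ := by
  ext l
  simp [swapEquiv_apply, Equiv.swap_comm j i]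

/-- Consistency of the inclusion process: the sum of a function of `k` particles over all
choices of `k` among `n` particles evolves by the `k`-particle dynamics. -/
theorem sipGen_sum_embedding {k n : ℕ} (m : ℝ) (h : Conf k → ℝ) (y : Conf n) :
    sipGen m (fun y => ∑ σ : Fin k ↪ Fin n, h (y ∘ σ)) y =
      ∑ σ : Fin k ↪ Fin n, sipGen m h (y ∘ σ) := by
  classical
  simp only [sipGen_eq, Finset.sum_add_distrib]
  congr 1
  · rw [Finset.sum_comm' (t' := ({1, -1} : Finset ℤ)) (s' := fun _ => Finset.univ) (by simp)]
    refine Finset.sum_congr rfl fun e _ => ?_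
    simp only [← Finset.sum_sub_distrib, Finset.mul_sum]
    rw [Finset.sum_comm]
    refine Finset.sum_congr rfl fun σ _ => ?_
    refine (Fintype.sum_of_injective σ σ.injective _ _ (fun i hi => ?_) fun j => ?_).symm
    · rw [move_comp_of_notMem y σ hi, sub_self, mul_zero]
    · rw [move_comp]
  · set A : (Fin k ↪ Fin n) → ℤ → Fin n → Fin n → ℝ := fun σ e i j =>
      (if y j = y i + e then 1 else 0) * (h (move y i e ∘ σ) - h (y ∘ σ)) with hA
    set B : (Fin k ↪ Fin n) → ℤ → Fin n → Fin n → ℝ := fun σ e i j =>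
      if i ∈ Set.range σ ∧ j ∉ Set.range σ then A σ e i j else 0 with hB
    have hBanti : ∀ σ e i j, B (swapEquiv i j σ) (-e) j i = -B σ e i j := by
      intro σ e i j
      simp only [hB, mem_range_swapEquiv, Equiv.swap_apply_left, Equiv.swap_apply_right]
      by_cases hr : i ∈ Set.range σ ∧ j ∉ Set.range σ
      · rw [if_pos hr, if_pos hr]
        simp only [hA]
        by_cases hy : y j = y i + e
        · have hy' : y i = y j + -e := by omega
          rw [if_pos hy, if_pos hy', comp_swapEquiv y hy σ hr.2, ← comp_swapEquiv y hy' _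
            (by rw [mem_range_swapEquiv, Equiv.swap_apply_left]; exact hr.2),
            swapEquiv_swapEquiv]
          ring
        · have hy' : ¬ y i = y j + -e := by omega
          rw [if_neg hy, if_neg hy']
          simp
      · rw [if_neg hr, if_neg hr, neg_zero]
    have hZ : ∑ e ∈ ({1, -1} : Finset ℤ), ∑ i : Fin n, ∑ j : Fin n,
        ∑ σ : Fin k ↪ Fin n, B σ e i j = 0 := by
      have key : ∀ e : ℤ, ∑ i : Fin n, ∑ j : Fin n, ∑ σ : Fin k ↪ Fin n, B σ (-e) i j =
          -∑ i : Fin n, ∑ j : Fin n, ∑ σ : Fin k ↪ Fin n, B σ e i j := by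
        intro e
        rw [Finset.sum_comm]
        simp only [← Finset.sum_neg_distrib]
        refine Finset.sum_congr rfl fun i _ => Finset.sum_congr rfl fun j _ => ?_
        rw [← Equiv.sum_comp (swapEquiv i j)]
        exact Finset.sum_congr rfl fun σ _ => hBanti σ e i j
      rw [Finset.sum_pair (by decide), key 1, add_neg_cancel]
    have hsplit : ∀ σ e, ∑ i : Fin n, ∑ j : Fin n, A σ e i j =
        (∑ i : Fin k, ∑ j : Fin k, (if (y ∘ σ) j = (y ∘ σ) i + e then 1 else 0) *
          (h (move (y ∘ σ) i e) - h (y ∘ σ))) + ∑ i : Fin n, ∑ j : Fin n, B σ e i j := by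
      intro σ e
      rw [← sub_eq_iff_eq_add, ← Finset.sum_sub_distrib]
      refine (Fintype.sum_of_injective σ σ.injective _ _ (fun i hi => ?_) fun i => ?_).symm
      · rw [← Finset.sum_sub_distrib]
        refine Finset.sum_eq_zero fun j _ => ?_
        simp only [hB, hA]
        rw [if_neg (c := _ ∧ _) (fun hc => hi hc.1), move_comp_of_notMem y σ hi]
        simp
      · rw [← Finset.sum_sub_distrib]
        refine Fintype.sum_of_injective σ σ.injective _ _ (fun j hj => ?_) fun j => ?_
        · simp only [hB]
          rw [if_pos ⟨⟨i, rfl⟩, hj⟩, sub_self]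
        · have hj : ¬(σ i ∈ Set.range σ ∧ σ j ∉ Set.range σ) := fun hc => hc.2 ⟨j, rfl⟩
          simp only [hB, hA]
          rw [if_neg hj, move_comp, sub_zero]
          rfl
    have hL : ∑ e ∈ ({1, -1} : Finset ℤ), ∑ i : Fin n, ∑ j : Fin n,
        (if y j = y i + e then 1 else 0) *
          (∑ σ : Fin k ↪ Fin n, h (move y i e ∘ σ) - ∑ σ : Fin k ↪ Fin n, h (y ∘ σ)) =
        ∑ σ : Fin k ↪ Fin n, ∑ e ∈ ({1, -1} : Finset ℤ), ∑ i : Fin n, ∑ j : Fin n,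
          A σ e i j := by
      simp only [← Finset.sum_sub_distrib, Finset.mul_sum]
      symm
      rw [Finset.sum_comm]
      refine Finset.sum_congr rfl fun e _ => ?_
      rw [Finset.sum_comm]
      refine Finset.sum_congr rfl fun i _ => ?_
      rw [Finset.sum_comm]
    have hZ' : ∑ σ : Fin k ↪ Fin n, ∑ e ∈ ({1, -1} : Finset ℤ), ∑ i : Fin n, ∑ j : Fin n,
        B σ e i j = 0 := by
      rw [← hZ, Finset.sum_comm]
      refine Finset.sum_congr rfl fun e _ => ?_
      rw [Finset.sum_comm]
      refine Finset.sum_congr rfl fun i _ => ?_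
      rw [Finset.sum_comm]
    rw [hL]
    simp only [hsplit, Finset.sum_add_distrib]
    rw [hZ', add_zero]

theorem sum_embedding_two {n : ℕ} (g : Fin n → Fin n → ℝ) :
    ∑ σ : Fin 2 ↪ Fin n, g (σ 0) (σ 1) = ∑ a, ∑ b, if a ≠ b then g a b else 0 := by
  classical
  rw [← Fintype.sum_prod_type' (fun a b => if a ≠ b then g a b else 0), ← Finset.sum_filter,
    Finset.sum_subtype (p := fun x : Fin n × Fin n => x.1 ≠ x.2) _ (by simp)]
  exact Fintype.sum_equiv Function.Embedding.twoEmbeddingEquiv _ _ fun σ => rfl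

/-- The generator of the difference of the positions of two inclusion particles. -/
theorem sipGen_pair (m : ℝ) (w : ℤ → ℝ) (u : Conf 2) :
    sipGen m (fun u => w (u 0 - u 1)) u =
      m * (w (u 0 - u 1 + 1) + w (u 0 - u 1 - 1) - 2 * w (u 0 - u 1)) +
        2 * ((if |u 0 - u 1| = 1 then 1 else 0) * (w 0 - w (u 0 - u 1))) := by
  set z := u 0 - u 1 with hz
  have h0 : ∀ e, w (move u 0 e 0 - move u 0 e 1) = w (z + e) := fun e => by
    simp only [move_apply, if_true, one_ne_zero, if_false]; congr 1; omega
  have h1 : ∀ e, w (move u 1 e 0 - move u 1 e 1) = w (z - e) := fun e => by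
    simp only [move_apply, if_true, zero_ne_one, if_false]; congr 1; omega
  have i00 : ∀ i : Fin 2, ¬ u i = u i + 1 := fun i h => by omega
  have i00' : ∀ i : Fin 2, ¬ u i = u i - 1 := fun i h => by omega
  have i01 : ∀ e : ℤ, u 1 = u 0 + e ↔ z = -e := fun e => by omega
  have i10 : ∀ e : ℤ, u 0 = u 1 + e ↔ z = e := fun e => by omega
  rw [sipGen_eq]
  simp only [Finset.sum_pair (show (1 : ℤ) ≠ -1 by decide), Fin.sum_univ_two, h0, h1, i01, i10,
    i00, i00', if_false,
    abs_eq (zero_le_one' ℤ), ← hz, ← sub_eq_add_neg, sub_neg_eq_add, neg_neg]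
  rcases eq_or_ne z 1 with h | h
  · norm_num [h]; ring
  · rcases eq_or_ne z (-1) with h' | h'
    · norm_num [h']; ring
    · norm_num [h, h']; ring

/-- The distance of two particles, modified at coinciding positions. -/
noncomputable def absPot (a : ℝ) (z : ℤ) : ℝ := |(z : ℝ)| + if z = 0 then a else 0

theorem sipGen_absPot_ge {m : ℝ} (hm : 0 < m) (u : Conf 2) :
    m ^ 2 / (2 * (m + 2)) * (if |u 0 - u 1| ≤ 1 then 1 else 0) ≤
      sipGen m (fun u => absPot ((m + 4) / (2 * (m + 2))) (u 0 - u 1)) u := by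
  rw [sipGen_pair]
  set z := u 0 - u 1
  have hm2 : 0 < m + 2 := by linarith
  have ha : (m + 4) / (2 * (m + 2)) * (2 * (m + 2)) = m + 4 := by field_simp
  have hb : m ^ 2 / (2 * (m + 2)) * (2 * (m + 2)) = m ^ 2 := by field_simp
  set a := (m + 4) / (2 * (m + 2))
  set b := m ^ 2 / (2 * (m + 2))
  have hbm : b ≤ m / 2 := by
    by_contra hc
    nlinarith
  by_cases h0 : z = 0
  · norm_num [h0, absPot]
    nlinarith
  by_cases h1 : z = 1
  · norm_num [h1, absPot]
    nlinarith
  by_cases h2 : z = -1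
  · norm_num [h2, absPot]
    nlinarith
  have h3 : ¬ |z| ≤ 1 := by rw [abs_le]; omega
  have h4 : ¬ |z| = 1 := by omega
  rw [if_neg h3, if_neg h4]
  have h5 : z + 1 ≠ 0 := by omega
  have h6 : z - 1 ≠ 0 := by omega
  simp only [absPot, h0, h5, h6, if_false]
  rcases lt_or_gt_of_ne h0 with h | h
  · have : (z : ℝ) ≤ -2 := by exact_mod_cast (by omega : z ≤ -2)
    push_cast
    rw [abs_of_nonpos (by linarith), abs_of_nonpos (by linarith), abs_of_nonpos (by linarith)]
    linarith
  · have : 2 ≤ (z : ℝ) := by exact_mod_cast (by omega : 2 ≤ z)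
    push_cast
    rw [abs_of_nonneg (by linarith), abs_of_nonneg (by linarith), abs_of_nonneg (by linarith)]
    linarith

theorem sipGen_sq_le {m : ℝ} (u : Conf 2) :
    sipGen m (fun u => (((u 0 - u 1 : ℤ) : ℝ)) ^ 2) u ≤ 2 * m := by
  rw [sipGen_pair m (fun z => (z : ℝ) ^ 2)]
  push_cast
  split_ifs <;> nlinarith [sq_nonneg ((u 0 : ℝ) - u 1)]

/-- The pair potential whose generator exceeds the one of the squared distance of two random walks
when the particles are adjacent. -/
noncomputable def pairPot (g : ℝ) (z : ℤ) : ℝ := (z : ℝ) ^ 2 + g * max |(z : ℝ)| 1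

theorem sipGen_pairPot (m g : ℝ) (u : Conf 2) :
    sipGen m (fun u => pairPot g (u 0 - u 1)) u =
      2 * m + (m * g - 2) * (if |u 0 - u 1| = 1 then 1 else 0) := by
  rw [sipGen_pair]
  set z := u 0 - u 1
  by_cases h0 : z = 0
  · norm_num [h0, pairPot]
    ring
  by_cases h1 : z = 1
  · norm_num [h1, pairPot]
    ring
  by_cases h2 : z = -1
  · norm_num [h2, pairPot]
    ring
  have h4 : ¬ |z| = 1 := by rw [abs_eq (by norm_num)]; omega
  rw [if_neg h4]
  simp only [pairPot]
  rcases lt_or_gt_of_ne h0 with h | h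
  · have : (z : ℝ) ≤ -2 := by exact_mod_cast (by omega : z ≤ -2)
    push_cast
    rw [abs_of_nonpos (by linarith), abs_of_nonpos (by linarith), abs_of_nonpos (by linarith),
      max_eq_left (by linarith), max_eq_left (by linarith), max_eq_left (by linarith)]
    ring
  · have : 2 ≤ (z : ℝ) := by exact_mod_cast (by omega : 2 ≤ z)
    push_cast
    rw [abs_of_nonneg (by linarith), abs_of_nonneg (by linarith), abs_of_nonneg (by linarith),
      max_eq_left (by linarith), max_eq_left (by linarith), max_eq_left (by linarith)]
    ring

/-- The total pair potential of three particles. -/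
noncomputable def triPot (g : ℝ) (u : Conf 3) : ℝ :=
  pairPot g (u 0 - u 1) + pairPot g (u 0 - u 2) + pairPot g (u 1 - u 2)

/-- The number of adjacent pairs among three particles. -/
noncomputable def adjCount (u : Conf 3) : ℝ :=
  (if |u 0 - u 1| = 1 then 1 else 0) + (if |u 0 - u 2| = 1 then 1 else 0) +
    if |u 1 - u 2| = 1 then 1 else 0

theorem adjCount_nonneg (u : Conf 3) : 0 ≤ adjCount u := by
  unfold adjCount; positivity

theorem pairPot_neg (g : ℝ) (z : ℤ) : pairPot g (-z) = pairPot g z := by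
  simp [pairPot]

theorem sipGen_triPot (m g : ℝ) (u : Conf 3) :
    sipGen m (triPot g) u = 6 * m + (m * g - 2) * adjCount u := by
  have h1 : ∀ u : Conf 3, triPot g u =
      (1 / 2) * ∑ σ : Fin 2 ↪ Fin 3, pairPot g ((u ∘ σ) 0 - (u ∘ σ) 1) := by
    intro u
    have := sum_embedding_two fun a b => pairPot g (u a - u b)
    simp only [Function.comp_apply, this]
    simp only [Fin.sum_univ_three]
    rw [← pairPot_neg g (u 1 - u 0), ← pairPot_neg g (u 2 - u 0), ← pairPot_neg g (u 2 - u 1)]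
    simp [triPot]
    ring
  have h2 : sipGen m (triPot g) u = (1 / 2) * ∑ σ : Fin 2 ↪ Fin 3,
      sipGen m (fun v => pairPot g (v 0 - v 1)) (u ∘ σ) := by
    rw [← sipGen_sum_embedding m (fun v : Conf 2 => pairPot g (v 0 - v 1)) u]
    unfold sipGen
    rw [← gen_smul]
    congr 1
    funext q
    exact h1 q.1
  rw [h2]
  simp only [sipGen_pairPot]
  have := sum_embedding_two fun a b => 2 * m + (m * g - 2) * (if |u a - u b| = 1 then 1 else 0)
  simp only [Function.comp_apply, this]
  simp only [Fin.sum_univ_three]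
  rw [abs_sub_comm (u 1) (u 0), abs_sub_comm (u 2) (u 0), abs_sub_comm (u 2) (u 1)]
  simp [adjCount]
  split_ifs <;> ring

theorem le_sqrt_sqrt_one_add {u : ℝ} (hu : |u| ≤ 1 / 20) :
    1 + u / 4 - 7 / 64 * u ^ 2 ≤ √√(1 + u) := by
  obtain ⟨h1, h2⟩ := abs_le.1 hu
  have hu2 : u ^ 2 ≤ 1 / 400 := by nlinarith
  have hu3 : |u ^ 3| ≤ u ^ 2 / 20 := by
    rw [pow_succ, abs_mul, abs_of_nonneg (sq_nonneg u)]
    nlinarith [sq_nonneg u]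
  obtain ⟨h3, h4⟩ := abs_le.1 hu3
  have hu4 : u ^ 4 ≤ u ^ 2 / 400 := by nlinarith [sq_nonneg u]
  have hu4' : 0 ≤ u ^ 4 := by positivity
  have hw : (1 + u / 4 - 7 / 64 * u ^ 2) ^ 2 ≤ 1 + u / 2 - 19 / 128 * u ^ 2 := by
    have : (1 + u / 4 - 7 / 64 * u ^ 2) ^ 2 =
      1 + u / 2 - 5 / 32 * u ^ 2 - 7 / 128 * u ^ 3 + 49 / 4096 * u ^ 4 := by ring
    rw [this]
    linarith [sq_nonneg u]
  have hw2 : (1 + u / 2 - 19 / 128 * u ^ 2) ^ 2 ≤ 1 + u := by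
    have : (1 + u / 2 - 19 / 128 * u ^ 2) ^ 2 =
      1 + u - 3 / 64 * u ^ 2 - 19 / 128 * u ^ 3 + 361 / 16384 * u ^ 4 := by ring
    rw [this]
    linarith [sq_nonneg u]
  exact Real.le_sqrt_of_sq_le (hw.trans (Real.le_sqrt_of_sq_le hw2))

theorem sqrt_sqrt_sub_ge {x d : ℝ} (hx : 0 < x) (hd : |d| ≤ x / 20) :
    √√x / (4 * x) * (d - 7 / 16 / x * d ^ 2) ≤ √√(x + d) - √√x := by
  have h := le_sqrt_sqrt_one_add (u := d / x) (by
    rw [abs_div, abs_of_pos hx, div_le_iff₀ hx]; linarith)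
  have h1 : √√(x + d) = √√x * √√(1 + d / x) := by
    rw [← Real.sqrt_mul (Real.sqrt_nonneg _), ← Real.sqrt_mul hx.le]
    congr 2
    field_simp
  rw [h1]
  have h2 : √√x / (4 * x) * (d - 7 / 16 / x * d ^ 2) =
      √√x * (1 + d / x / 4 - 7 / 64 * (d / x) ^ 2) - √√x := by
    field_simp
    ring
  rw [h2]
  have := mul_le_mul_of_nonneg_left h (Real.sqrt_nonneg (√x))
  linarith

theorem pairPot_increments_sq_le {g : ℝ} (hg : 0 ≤ g) (z₁ z₂ e : ℤ) (he : e = 1 ∨ e = -1) :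
    (pairPot g (z₁ + e) - pairPot g z₁ + (pairPot g (z₂ + e) - pairPot g z₂)) ^ 2 ≤
      30 / 7 * ((z₁ : ℝ) + z₂) ^ 2 + 15 * (2 + 2 * g) ^ 2 := by
  have hmax : ∀ z : ℤ, |max |((z + e : ℤ) : ℝ)| 1 - max |(z : ℝ)| 1| ≤ 1 := by
    intro z
    refine (abs_max_sub_max_le_abs _ _ _).trans ((abs_abs_sub_abs_le _ _).trans ?_)
    rcases he with rfl | rfl <;> simp
  have he2 : (e : ℝ) ^ 2 = 1 := by rcases he with rfl | rfl <;> norm_num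
  obtain ⟨a1, a2⟩ := abs_le.1 (hmax z₁)
  obtain ⟨b1, b2⟩ := abs_le.1 (hmax z₂)
  set r₁ := max |((z₁ + e : ℤ) : ℝ)| 1 - max |(z₁ : ℝ)| 1 with hr₁
  set r₂ := max |((z₂ + e : ℤ) : ℝ)| 1 - max |(z₂ : ℝ)| 1 with hr₂
  have hform : pairPot g (z₁ + e) - pairPot g z₁ + (pairPot g (z₂ + e) - pairPot g z₂) =
      2 * e * ((z₁ : ℝ) + z₂) + (2 + g * (r₁ + r₂)) := by
    simp only [pairPot, hr₁, hr₂]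
    push_cast
    linear_combination 2 * he2
  rw [hform]
  have hρ : (2 + g * (r₁ + r₂)) ^ 2 ≤ (2 + 2 * g) ^ 2 :=
    sq_le_sq' (by nlinarith) (by nlinarith)
  have ha : (2 * e * ((z₁ : ℝ) + z₂)) ^ 2 = 4 * ((z₁ : ℝ) + z₂) ^ 2 := by
    linear_combination 4 * ((z₁ : ℝ) + z₂) ^ 2 * he2
  nlinarith [sq_nonneg (2 * e * ((z₁ : ℝ) + z₂) - 14 * (2 + g * (r₁ + r₂)))]

/-- The sum of the displacements of particle `i` from the two others. -/
noncomputable def pull (u : Conf 3) (i : Fin 3) : ℝ := 3 * (u i : ℝ) - (u 0 + u 1 + u 2)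

theorem triPot_move_sub_sq_le {g : ℝ} (hg : 0 ≤ g) (u : Conf 3) (i : Fin 3) (e : ℤ)
    (he : e = 1 ∨ e = -1) :
    (triPot g (move u i e) - triPot g u) ^ 2 ≤ 30 / 7 * pull u i ^ 2 + 15 * (2 + 2 * g) ^ 2 := by
  fin_cases i
  · have h := pairPot_increments_sq_le hg (u 0 - u 1) (u 0 - u 2) e he
    convert h using 2
    · simp [triPot, move_apply, sub_add_eq_add_sub]
      ring
    · simp [pull]; ring
  · have h := pairPot_increments_sq_le hg (u 1 - u 0) (u 1 - u 2) e he
    convert h using 2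
    · rw [← pairPot_neg g (u 1 - u 0), ← pairPot_neg g (u 1 - u 0 + e)]
      simp [triPot, move_apply, sub_add_eq_add_sub]
      ring_nf
    · simp [pull]; ring
  · have h := pairPot_increments_sq_le hg (u 2 - u 0) (u 2 - u 1) e he
    convert h using 2
    · rw [← pairPot_neg g (u 2 - u 0), ← pairPot_neg g (u 2 - u 0 + e),
        ← pairPot_neg g (u 2 - u 1), ← pairPot_neg g (u 2 - u 1 + e)]
      simp [triPot, move_apply, sub_add_eq_add_sub]
      ring_nf
    · simp [pull]; ring

theorem sq_le_pairPot {g : ℝ} (hg : 0 ≤ g) (z : ℤ) : (z : ℝ) ^ 2 ≤ pairPot g z := by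
  unfold pairPot
  have : 0 ≤ max |(z : ℝ)| 1 := le_max_of_le_right zero_le_one
  nlinarith

theorem sum_pull_sq_le {g : ℝ} (hg : 0 ≤ g) (u : Conf 3) :
    ∑ i, pull u i ^ 2 ≤ 3 * triPot g u := by
  have h1 := sq_le_pairPot hg (u 0 - u 1)
  have h2 := sq_le_pairPot hg (u 0 - u 2)
  have h3 := sq_le_pairPot hg (u 1 - u 2)
  push_cast at h1 h2 h3
  simp only [Fin.sum_univ_three, pull, triPot]
  nlinarith

theorem pull_sq_le {g : ℝ} (hg : 0 ≤ g) (u : Conf 3) (i : Fin 3) :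
    pull u i ^ 2 ≤ 2 * triPot g u := by
  have h1 := sq_le_pairPot hg (u 0 - u 1)
  have h2 := sq_le_pairPot hg (u 0 - u 2)
  have h3 := sq_le_pairPot hg (u 1 - u 2)
  push_cast at h1 h2 h3
  simp only [pull, triPot]
  fin_cases i <;> simp <;> nlinarith [sq_nonneg ((u 0 : ℝ) - u 1 - (u 0 - u 2)),
    sq_nonneg ((u 0 : ℝ) - u 1 - (u 1 - u 2)), sq_nonneg ((u 0 : ℝ) - u 2 + (u 1 - u 2)),
    sq_nonneg ((u 0 : ℝ) - u 1), sq_nonneg ((u 0 : ℝ) - u 2), sq_nonneg ((u 1 : ℝ) - u 2),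
    sq_nonneg ((u 0 : ℝ) - u 1 + (u 1 - u 2)), sq_nonneg ((u 0 : ℝ) - u 2 - (u 1 - u 2))]

theorem ite_adjacent (a b : ℤ) :
    ((if b = a + 1 then 1 else 0) + (if b = a + -1 then 1 else 0) : ℝ) =
      if |a - b| = 1 then 1 else 0 := by
  have h : |a - b| = 1 ↔ b = a + 1 ∨ b = a + -1 := by
    rw [abs_eq (by norm_num)]; omega
  simp only [h]
  by_cases h1 : b = a + 1
  · have : ¬ b = a + -1 := by omega
    simp [h1]
  · simp [h1]

theorem sum_adjacent (u : Conf 3) :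
    ∑ e ∈ ({1, -1} : Finset ℤ), ∑ i : Fin 3, ∑ k : Fin 3,
      (if u k = u i + e then (1 : ℝ) else 0) = 2 * adjCount u := by
  rw [Finset.sum_pair (by decide), ← Finset.sum_add_distrib]
  simp only [← Finset.sum_add_distrib, ite_adjacent]
  simp only [Fin.sum_univ_three, adjCount]
  rw [abs_sub_comm (u 1) (u 0), abs_sub_comm (u 2) (u 0), abs_sub_comm (u 2) (u 1)]
  simp
  ring

theorem triPot_nonneg {g : ℝ} (hg : 0 ≤ g) (u : Conf 3) : 0 ≤ triPot g u := by
  have h := sum_pull_sq_le hg u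
  have : 0 ≤ ∑ i, pull u i ^ 2 := Finset.sum_nonneg fun i _ => sq_nonneg _
  linarith

theorem sipGen_triPot_sub_sq_le {m g : ℝ} (hm : 0 ≤ m) (hg : 0 ≤ g) (u : Conf 3) :
    sipGen m (fun v => (triPot g v - triPot g u) ^ 2) u ≤
      m * (90 / 7 * triPot g u + 45 * (2 + 2 * g) ^ 2) +
        2 * adjCount u * (60 / 7 * triPot g u + 15 * (2 + 2 * g) ^ 2) := by
  rw [sipGen_eq]
  have he : ∀ e ∈ ({1, -1} : Finset ℤ), e = 1 ∨ e = -1 := fun e he => by simpa using he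
  refine add_le_add ?_ ?_
  · have h1 : ∀ e ∈ ({1, -1} : Finset ℤ), ∑ i : Fin 3, m / 2 *
        ((triPot g (move u i e) - triPot g u) ^ 2 - (triPot g u - triPot g u) ^ 2) ≤
        m / 2 * (90 / 7 * triPot g u + 45 * (2 + 2 * g) ^ 2) := by
      intro e h
      rw [← Finset.mul_sum]
      refine mul_le_mul_of_nonneg_left ?_ (by positivity)
      refine (Finset.sum_le_sum fun i _ => ?_ : _ ≤ ∑ i : Fin 3, (30 / 7 * pull u i ^ 2 +
        15 * (2 + 2 * g) ^ 2)).trans ?_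
      · have := triPot_move_sub_sq_le hg u i e (he e h)
        simpa using this
      · rw [Finset.sum_add_distrib, ← Finset.mul_sum]
        have := sum_pull_sq_le hg u
        simp only [Finset.sum_const, Finset.card_univ, Fintype.card_fin, nsmul_eq_mul]
        push_cast
        linarith
    refine (Finset.sum_le_sum h1).trans (le_of_eq ?_)
    rw [Finset.sum_pair (by decide)]
    ring
  · rw [← sum_adjacent]
    simp only [Finset.sum_mul]
    refine Finset.sum_le_sum fun e h => Finset.sum_le_sum fun i _ => Finset.sum_le_sum fun k _ => ?_
    refine mul_le_mul_of_nonneg_left ?_ (by positivity)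
    have := triPot_move_sub_sq_le hg u i e (he e h)
    have := pull_sq_le hg u i
    simp only [sub_self]
    linarith

/-- A slowly growing potential of three particles whose generator charges triple collisions. -/
noncomputable def rootPot (m : ℝ) (u : Conf 3) : ℝ :=
  √√(6400 + 200 * (2 + 2 * (16 / m)) ^ 2 + triPot (16 / m) u)

theorem sipGen_rootPot_ge {m : ℝ} (hm : 0 < m) (u : Conf 3) :
    m / 5 * (rootPot m u / (4 * (6400 + 200 * (2 + 2 * (16 / m)) ^ 2 + triPot (16 / m) u))) ≤
      sipGen m (rootPot m) u := by
  set g := 16 / m with hg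
  have hmg : m * g = 16 := by rw [hg]; field_simp
  have hg0 : 0 ≤ g := by positivity
  set R := (2 + 2 * g) ^ 2 with hR
  have hR0 : 0 ≤ R := sq_nonneg _
  have hQ0 := triPot_nonneg hg0 u
  set x := 6400 + 200 * R + triPot g u with hx
  have hx0 : 6400 ≤ x := by linarith
  have hxpos : 0 < x := by linarith
  have hroot : rootPot m u = √√x := rfl
  set α := √√x / (4 * x) with hα
  have hα0 : 0 ≤ α := by positivity
  have hN := adjCount_nonneg u
  have hjump : ∀ i e, e = 1 ∨ e = -1 → |triPot g (move u i e) - triPot g u| ≤ x / 20 := by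
    intro i e he
    have h1 := triPot_move_sub_sq_le hg0 u i e he
    have h2 := pull_sq_le hg0 u i
    refine abs_le_of_sq_le_sq (h1.trans ?_) (by positivity)
    nlinarith
  have hstep : α * (sipGen m (triPot g) u - 7 / 16 / x *
      sipGen m (fun v => (triPot g v - triPot g u) ^ 2) u) ≤ sipGen m (rootPot m) u := by
    have hlin : α * (sipGen m (triPot g) u - 7 / 16 / x *
        sipGen m (fun v => (triPot g v - triPot g u) ^ 2) u) =
        gen m (fun q : Conf 3 × Conf 3 => α * (triPot g q.1 - 7 / 16 / x *
          (triPot g q.1 - triPot g u) ^ 2)) (u, u) := by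
      rw [gen_smul, gen_sub, gen_smul]; rfl
    rw [hlin]
    unfold sipGen
    have main : ∀ i e, e = 1 ∨ e = -1 →
        α * (triPot g (move u i e) - 7 / 16 / x * (triPot g (move u i e) - triPot g u) ^ 2) -
          α * (triPot g u - 7 / 16 / x * (triPot g u - triPot g u) ^ 2) ≤
        rootPot m (move u i e) - rootPot m u := by
      intro i e he
      have h := sqrt_sqrt_sub_ge hxpos (hjump i e he)
      have hadd : x + (triPot g (move u i e) - triPot g u) =
        6400 + 200 * R + triPot g (move u i e) := by rw [hx]; ring
      rw [hadd] at h
      change _ ≤ √√(6400 + 200 * R + triPot g (move u i e)) - √√x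
      rw [hα]
      refine le_trans (le_of_eq ?_) h
      ring
    refine gen_le_gen hm.le fun q hq => ?_
    rcases hq with ⟨i, e, he, rfl⟩ | ⟨i, k, e, he, -, rfl⟩
    · exact main i e (by simpa using he)
    · exact main i e (by simpa using he)
  refine le_trans ?_ hstep
  rw [hroot, mul_comm]
  change α * (m / 5) ≤ _
  refine mul_le_mul_of_nonneg_left ?_ hα0
  have hΓ := sipGen_triPot_sub_sq_le hm.le hg0 u
  set Γ := sipGen m (fun v => (triPot g v - triPot g u) ^ 2) u
  rw [sipGen_triPot, hmg]
  have hΓx : 7 / 16 / x * Γ ≤ 29 / 5 * m + 14 * adjCount u := by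
    rw [div_div, div_mul_eq_mul_div, div_le_iff₀ (by positivity)]
    have e2 : 60 / 7 * triPot g u + 15 * R ≤ 16 * x := by linarith
    have e3 : 7 * (90 / 7 * triPot g u + 45 * R) ≤ 16 * (29 / 5) * x := by linarith
    have e4 := mul_le_mul_of_nonneg_left e3 hm.le
    have e5 := mul_le_mul_of_nonneg_left e2 hN
    nlinarith
  linarith

theorem exists_le_sipGen_rootPot {m : ℝ} (hm : 0 < m) : ∃ c > 0, ∀ u : Conf 3,
    c * (if |u 0 - u 1| ≤ 1 ∧ |u 0 - u 2| ≤ 1 then 1 else 0) ≤ sipGen m (rootPot m) u := by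
  set g := 16 / m with hg
  have hg0 : 0 ≤ g := by positivity
  set x₀ := 6400 + 200 * (2 + 2 * g) ^ 2 + (12 + 6 * g) with hx₀
  have hx₀pos : 0 < x₀ := by positivity
  refine ⟨m / 5 * (1 / (4 * x₀)), by positivity, fun u => ?_⟩
  have h := sipGen_rootPot_ge hm u
  have hQ0 := triPot_nonneg hg0 u
  have hR : 0 ≤ (2 + 2 * g) ^ 2 := sq_nonneg _
  have hroot1 : 1 ≤ rootPot m u := by
    refine Real.le_sqrt_of_sq_le (Real.le_sqrt_of_sq_le ?_)
    linarith
  refine le_trans ?_ h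
  rw [mul_assoc]
  refine mul_le_mul_of_nonneg_left ?_ (by positivity)
  split_ifs with hu
  · have hq : ∀ z : ℤ, |z| ≤ 2 → pairPot g z ≤ 4 + 2 * g := by
      intro z hz
      have hz' : |(z : ℝ)| ≤ 2 := by exact_mod_cast hz
      have h1 : max |(z : ℝ)| 1 ≤ 2 := max_le hz' (by norm_num)
      have h2 : (z : ℝ) ^ 2 ≤ 4 := by rw [← sq_abs]; nlinarith [abs_nonneg (z : ℝ)]
      unfold pairPot
      nlinarith
    obtain ⟨h1, h2⟩ := hu
    rw [abs_le] at h1 h2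
    have q1 := hq (u 0 - u 1) (by rw [abs_le]; omega)
    have q2 := hq (u 0 - u 2) (by rw [abs_le]; omega)
    have q3 := hq (u 1 - u 2) (by rw [abs_le]; omega)
    rw [mul_one]
    refine div_le_div₀ (by positivity) hroot1 (by positivity) ?_
    have : triPot g u ≤ 12 + 6 * g := by unfold triPot; linarith
    linarith
  · rw [mul_zero]
    positivity

/-- As long as the particles labelled by `σ` are not affected by the others, they evolve as an
inclusion process of their own. -/
theorem sipGen_comp_embedding {k n : ℕ} (m : ℝ) (h : Conf k → ℝ) (y : Conf n)
    (σ : Fin k ↪ Fin n)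
    (hσ : ∀ j, ∀ e ∈ ({1, -1} : Finset ℤ), ∀ b ∉ Set.range σ, y b = y (σ j) + e →
      h (move (y ∘ σ) j e) = h (y ∘ σ)) :
    sipGen m (fun y => h (y ∘ σ)) y = sipGen m h (y ∘ σ) := by
  simp only [sipGen_eq]
  congr 1
  · refine Finset.sum_congr rfl fun e _ => ?_
    refine (Fintype.sum_of_injective σ σ.injective _ _ (fun i hi => ?_) fun j => ?_).symm
    · rw [move_comp_of_notMem y σ hi, sub_self, mul_zero]
    · rw [move_comp]
  · refine Finset.sum_congr rfl fun e he => ?_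
    refine (Fintype.sum_of_injective σ σ.injective _ _ (fun i hi => ?_) fun j => ?_).symm
    · refine Finset.sum_eq_zero fun b _ => ?_
      rw [move_comp_of_notMem y σ hi, sub_self, mul_zero]
    · refine Fintype.sum_of_injective σ σ.injective _ _ (fun b hb => ?_) fun l => ?_
      · split_ifs with hy
        · rw [move_comp, hσ j e he b hb hy, sub_self, mul_zero]
        · rw [zero_mul]
      · rw [move_comp]; rfl

/-- No three particles are such that one of them is within distance one of the two others. -/
def NoTriple {n : ℕ} (y : Conf n) : Prop :=
  ∀ a b c : Fin n, a ≠ b → a ≠ c → b ≠ c → |y a - y b| ≤ 1 → 1 < |y a - y c|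

/-- No two particles are within distance one. -/
def NoPair {n : ℕ} (y : Conf n) : Prop :=
  ∀ a b : Fin n, a ≠ b → 1 < |y a - y b|

theorem sign_add_eq {z e : ℤ} (hz : 1 < |z|) (he : |e| ≤ 1) : (z + e).sign = z.sign := by
  rw [abs_le] at he
  rcases lt_abs.1 hz with h | h
  · rw [Int.sign_eq_one_of_pos (by omega), Int.sign_eq_one_of_pos (by omega)]
  · rw [Int.sign_eq_neg_one_of_neg (by omega), Int.sign_eq_neg_one_of_neg (by omega)]

theorem sipGen_sign {n : ℕ} (m : ℝ) {y : Conf n} (hy : NoTriple y) {i k : Fin n} (hik : i ≠ k) :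
    sipGen m (fun y => (((y i - y k).sign : ℤ) : ℝ)) y =
      -(m + 2) * ((if y i - y k = 1 then 1 else 0) - (if y i - y k = -1 then 1 else 0)) := by
  let σ : Fin 2 ↪ Fin n := ⟨![i, k], by
    intro a b hab
    fin_cases a <;> fin_cases b <;> simp_all [eq_comm]⟩
  have h0 : σ 0 = i := rfl
  have h1 : σ 1 = k := rfl
  have hrange : ∀ b ∉ Set.range σ, b ≠ i ∧ b ≠ k := fun b hb =>
    ⟨fun h => hb ⟨0, h0.trans h.symm⟩, fun h => hb ⟨1, h1.trans h.symm⟩⟩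
  have h := sipGen_comp_embedding m (fun u : Conf 2 => (((u 0 - u 1).sign : ℤ) : ℝ)) y σ (by
    intro j e he b hb hyb
    obtain ⟨hbi, hbk⟩ := hrange b hb
    have he1 : |e| ≤ 1 := by
      rw [abs_le]
      simp only [Finset.mem_insert, Finset.mem_singleton] at he
      omega
    norm_cast
    fin_cases j
    · replace hyb : y b = y i + e := hyb
      have hz : 1 < |y i - y k| := hy i b k hbi.symm hik hbk (by
        rw [hyb, abs_le] at *; omega)
      simp only [Fin.zero_eta, move_apply, Function.comp_apply, h0, h1, if_true, one_ne_zero,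
        if_false]
      rw [add_sub_right_comm, sign_add_eq hz he1]
    · replace hyb : y b = y k + e := hyb
      have hz : 1 < |y k - y i| := hy k b i hbk.symm hik.symm hbi (by
        rw [hyb, abs_le] at *; omega)
      rw [abs_sub_comm] at hz
      simp only [Fin.mk_one, move_apply, Function.comp_apply, h0, h1, if_true, zero_ne_one,
        if_false]
      rw [← sub_sub, sub_eq_add_neg _ e, sign_add_eq hz (by rwa [abs_neg])])
  have h' : sipGen m (fun y => (((y i - y k).sign : ℤ) : ℝ)) y =
      sipGen m (fun u : Conf 2 => (((u 0 - u 1).sign : ℤ) : ℝ)) (y ∘ σ) := h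
  rw [h', sipGen_pair m (fun z => ((z.sign : ℤ) : ℝ))]
  simp only [Function.comp_apply, h0, h1]
  generalize y i - y k = z
  have hsign2 : Int.sign 2 = 1 := by decide
  by_cases hz0 : z = 0
  · simp [hz0]
  by_cases hz1 : z = 1
  · norm_num [hz1]; rw [hsign2]; push_cast; ring
  by_cases hz2 : z = -1
  · norm_num [hz2]; rw [hsign2]; push_cast; ring
  have hz : 1 < |z| := by
    rw [lt_abs]; omega
  have hz3 : |z| ≠ 1 := hz.ne'
  rw [sub_eq_add_neg z 1, sign_add_eq hz (by simp), sign_add_eq hz (by simp)]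
  simp only [hz1, hz2, hz3, if_false]
  ring

/-- The discrepancy of particle `i`, corrected so that the drift is due to triple collisions
only. -/
noncomputable def discr {n : ℕ} (m : ℝ) (i : Fin n) (p : Conf n × Conf n) : ℝ :=
  ((p.1 i : ℝ) - p.2 i) - 1 / (m + 2) * ∑ k, (((p.1 i - p.1 k).sign : ℤ) : ℝ)

theorem gen_discr {n : ℕ} {m : ℝ} (hm : 0 < m) (i : Fin n) {p : Conf n × Conf n}
    (hp : NoTriple p.1) : gen m (discr m i) p = 0 := by
  classical
  have hm2 : m + 2 ≠ 0 := by linarith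
  have h1 : gen m (fun q : Conf n × Conf n => (q.1 i : ℝ) - q.2 i) p =
      ∑ k, ((if p.1 i - p.1 k = -1 then 1 else 0) - (if p.1 i - p.1 k = 1 then 1 else 0)) := by
    unfold gen
    have hrw : ∀ (e : ℤ) (a : Fin n), m / 2 * (((move p.1 a e i : ℤ) : ℝ) - (move p.2 a e i : ℤ) -
        ((p.1 i : ℝ) - p.2 i)) = 0 := by
      intro e a
      by_cases h : i = a
      · subst h; rw [move_apply_self, move_apply_self]; push_cast; ring
      · rw [move_apply_of_ne _ h, move_apply_of_ne _ h]; ring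
    have hinc : ∀ e : ℤ, ∑ a : Fin n, ∑ b : Fin n, (if p.1 b = p.1 a + e then 1 else 0) *
        (((move p.1 a e i : ℤ) : ℝ) - p.2 i - ((p.1 i : ℝ) - p.2 i)) =
        ∑ b : Fin n, (if p.1 b = p.1 i + e then (1 : ℝ) else 0) * e := by
      intro e
      rw [Finset.sum_eq_single i]
      · refine Finset.sum_congr rfl fun b _ => ?_
        rw [move_apply_self]; push_cast; ring
      · intro a _ ha
        refine Finset.sum_eq_zero fun b _ => ?_
        rw [move_apply_of_ne _ ha.symm]; ring
      · simp
    simp only [hrw, hinc, Finset.sum_const_zero, zero_add]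
    rw [Finset.sum_pair (by decide), ← Finset.sum_add_distrib]
    refine Finset.sum_congr rfl fun b _ => ?_
    have e1 : p.1 b = p.1 i + 1 ↔ p.1 i - p.1 b = -1 := by omega
    have e2 : p.1 b = p.1 i + -1 ↔ p.1 i - p.1 b = 1 := by omega
    simp only [e1, e2]
    push_cast
    ring
  have h2 : ∀ k, gen m (fun q : Conf n × Conf n => (((q.1 i - q.1 k).sign : ℤ) : ℝ)) p =
      -(m + 2) * ((if p.1 i - p.1 k = 1 then 1 else 0) -
        (if p.1 i - p.1 k = -1 then 1 else 0)) := by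
    intro k
    by_cases hik : i = k
    · subst hik
      simp [gen_const]
    · rw [← sipGen_sign m hp hik]; rfl
  unfold discr
  rw [gen_sub, gen_smul, gen_sum, h1]
  simp only [h2]
  rw [← Finset.mul_sum, ← mul_assoc, show 1 / (m + 2) * -(m + 2) = -1 by field_simp,
    neg_one_mul, sub_neg_eq_add, ← Finset.sum_add_distrib]
  exact Finset.sum_eq_zero fun k _ => by ring

theorem abs_discr_sub_le {n : ℕ} {m : ℝ} (hm : 0 < m) (i : Fin n) {p q : Conf n × Conf n}
    (h : Jump p q) : |discr m i q - discr m i p| ≤ 1 + n := by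
  have hd : |((q.1 i : ℝ) - q.2 i) - ((p.1 i : ℝ) - p.2 i)| ≤ 1 := by
    rcases h with ⟨a, e, he, rfl⟩ | ⟨a, k, e, he, -, rfl⟩
    · simp only [move_apply]
      split_ifs with h
      · subst h; push_cast; ring_nf; simp
      · simp
    · simp only [move_apply]
      split_ifs with h
      · subst h
        simp only [Finset.mem_insert, Finset.mem_singleton] at he
        rcases he with rfl | rfl <;> push_cast <;> ring_nf <;> simp
      · simp
  have hs : ∀ z w : ℤ, |((z.sign : ℤ) : ℝ) - (w.sign : ℤ)| ≤ 2 := by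
    intro z w
    have h1 : |z.sign - w.sign| ≤ 2 := by
      rcases Int.sign_trichotomy z with h | h | h <;>
        rcases Int.sign_trichotomy w with h' | h' | h' <;> rw [h, h'] <;> norm_num
    exact_mod_cast h1
  have hsum : |∑ k, (((q.1 i - q.1 k).sign : ℤ) : ℝ) - ∑ k, (((p.1 i - p.1 k).sign : ℤ) : ℝ)| ≤
      2 * n := by
    rw [← Finset.sum_sub_distrib]
    refine (Finset.abs_sum_le_sum_abs _ _).trans ((Finset.sum_le_sum fun k _ => hs _ _).trans ?_)
    simp [mul_comm]
  have hc : 0 < 1 / (m + 2) := by positivity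
  have hc2 : 1 / (m + 2) ≤ 1 / 2 := one_div_le_one_div_of_le (by norm_num) (by linarith)
  have hform : discr m i q - discr m i p = (((q.1 i : ℝ) - q.2 i) - ((p.1 i : ℝ) - p.2 i)) -
      1 / (m + 2) * (∑ k, (((q.1 i - q.1 k).sign : ℤ) : ℝ) -
        ∑ k, (((p.1 i - p.1 k).sign : ℤ) : ℝ)) := by
    unfold discr; ring
  rw [hform]
  refine (abs_sub _ _).trans (add_le_add hd ?_)
  rw [abs_mul, abs_of_pos hc]
  calc _ ≤ 1 / 2 * (2 * (n : ℝ)) := mul_le_mul hc2 hsum (abs_nonneg _) (by norm_num)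
    _ = n := by ring

theorem discr_eq_of_noPair {n : ℕ} (m : ℝ) (i : Fin n) {p q : Conf n × Conf n} (hp : NoPair p.1)
    (h : Jump p q) : discr m i q = discr m i p := by
  rcases h with ⟨a, e, he, rfl⟩ | ⟨a, k, e, he, hk, rfl⟩
  · have he1 : |e| ≤ 1 := by
      rw [abs_le]
      simp only [Finset.mem_insert, Finset.mem_singleton] at he
      omega
    have hd : ((move p.1 a e i : ℤ) : ℝ) - (move p.2 a e i : ℤ) = (p.1 i : ℝ) - p.2 i := by
      simp only [move_apply]
      split_ifs with h
      · subst h; push_cast; ring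
      · rfl
    unfold discr
    dsimp only
    rw [hd]
    congr 2
    refine Finset.sum_congr rfl fun k _ => ?_
    congr 1
    by_cases hik : i = k
    · subst hik; simp
    have hz := hp i k hik
    simp only [move_apply]
    split_ifs with h1 h2 h2
    · exact absurd (h1.trans h2.symm) hik
    · subst h1
      rw [add_sub_right_comm, sign_add_eq hz he1]
    · subst h2
      rw [← sub_sub, sub_eq_add_neg _ e, sign_add_eq hz (by rwa [abs_neg])]
    · rfl
  · exfalso
    simp only [Finset.mem_insert, Finset.mem_singleton] at he
    have hka : a ≠ k := by
      rintro rfl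
      omega
    have := hp a k hka
    rw [lt_abs] at this
    omega

/-- The number of ordered pairs of particles within distance one. -/
noncomputable def pairCount {n : ℕ} (y : Conf n) : ℝ :=
  ∑ σ : Fin 2 ↪ Fin n, if |y (σ 0) - y (σ 1)| ≤ 1 then 1 else 0

/-- The number of ordered triples of particles, the first of which is within distance one of the
two others. -/
noncomputable def tripleCount {n : ℕ} (y : Conf n) : ℝ :=
  ∑ σ : Fin 3 ↪ Fin n, if |y (σ 0) - y (σ 1)| ≤ 1 ∧ |y (σ 0) - y (σ 2)| ≤ 1 then 1 else 0

theorem pairCount_nonneg {n : ℕ} (y : Conf n) : 0 ≤ pairCount y :=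
  Finset.sum_nonneg fun σ _ => by positivity

theorem tripleCount_nonneg {n : ℕ} (y : Conf n) : 0 ≤ tripleCount y :=
  Finset.sum_nonneg fun σ _ => by positivity

theorem one_le_pairCount {n : ℕ} {y : Conf n} (hy : ¬ NoPair y) : 1 ≤ pairCount y := by
  unfold NoPair at hy
  push Not at hy
  obtain ⟨a, b, hab, h⟩ := hy
  let σ : Fin 2 ↪ Fin n := ⟨![a, b], by
    intro i j hij
    fin_cases i <;> fin_cases j <;> simp_all [eq_comm]⟩
  have hσ : |y (σ 0) - y (σ 1)| ≤ 1 := h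
  have := Finset.single_le_sum (f := fun σ : Fin 2 ↪ Fin n =>
    if |y (σ 0) - y (σ 1)| ≤ 1 then (1 : ℝ) else 0) (fun σ _ => by positivity)
    (Finset.mem_univ σ)
  simp only [hσ, if_true] at this
  exact this

theorem one_le_tripleCount {n : ℕ} {y : Conf n} (hy : ¬ NoTriple y) : 1 ≤ tripleCount y := by
  unfold NoTriple at hy
  push Not at hy
  obtain ⟨a, b, c, hab, hac, hbc, h, h'⟩ := hy
  let σ : Fin 3 ↪ Fin n := ⟨![a, b, c], by
    intro i j hij
    fin_cases i <;> fin_cases j <;> simp_all [eq_comm]⟩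
  have hσ : |y (σ 0) - y (σ 1)| ≤ 1 ∧ |y (σ 0) - y (σ 2)| ≤ 1 := ⟨h, h'⟩
  have := Finset.single_le_sum (f := fun σ : Fin 3 ↪ Fin n =>
    if |y (σ 0) - y (σ 1)| ≤ 1 ∧ |y (σ 0) - y (σ 2)| ≤ 1 then (1 : ℝ) else 0)
    (fun σ _ => by positivity) (Finset.mem_univ σ)
  simp only [hσ, and_self, if_true] at this
  exact this

theorem sqrt_sq_add_sq_sub_le {s : ℝ} (hs : 0 < s) (x d : ℝ) :
    √(s ^ 2 + (x + d) ^ 2) - √(s ^ 2 + x ^ 2) ≤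
      x / √(s ^ 2 + x ^ 2) * d + 1 / (2 * s) * d ^ 2 := by
  set G := √(s ^ 2 + x ^ 2) with hG
  have hG2 : G ^ 2 = s ^ 2 + x ^ 2 := Real.sq_sqrt (by positivity)
  have hsG : s ≤ G := Real.le_sqrt_of_sq_le (by nlinarith [sq_nonneg x])
  have hGpos : 0 < G := hs.trans_le hsG
  have h1 : √(s ^ 2 + (x + d) ^ 2) ≤ G + (2 * x * d + d ^ 2) / (2 * G) := by
    refine Real.sqrt_le_iff.2 ⟨?_, ?_⟩
    · have : G + (2 * x * d + d ^ 2) / (2 * G) = (G ^ 2 + (s ^ 2 + (x + d) ^ 2)) / (2 * G) := by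
        rw [hG2]; field_simp; rw [hG2]; ring
      rw [this]; positivity
    · have : (G + (2 * x * d + d ^ 2) / (2 * G)) ^ 2 =
        G ^ 2 + (2 * x * d + d ^ 2) + ((2 * x * d + d ^ 2) / (2 * G)) ^ 2 := by
        field_simp; ring
      rw [this, hG2]
      nlinarith [sq_nonneg ((2 * x * d + d ^ 2) / (2 * G))]
  have h2 : (2 * x * d + d ^ 2) / (2 * G) = x / G * d + 1 / (2 * G) * d ^ 2 := by
    field_simp
  have h3 : 1 / (2 * G) ≤ 1 / (2 * s) := one_div_le_one_div_of_le (by positivity) (by linarith)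
  have h4 := mul_le_mul_of_nonneg_right h3 (sq_nonneg d)
  linarith

theorem gen_sqrt_discr_le {n : ℕ} {m : ℝ} (hm : 0 < m) (i : Fin n) {s : ℝ} (hs : 0 < s)
    (p : Conf n × Conf n) :
    gen m (fun q => √(s ^ 2 + discr m i q ^ 2)) p ≤
      rate n m * (1 + n) ^ 2 / s * pairCount p.1 + rate n m * (1 + n) * tripleCount p.1 := by
  set X := discr m i with hX
  set G := √(s ^ 2 + X p ^ 2) with hG
  have hr := rate_nonneg (n := n) hm.le
  have hstep : gen m (fun q => √(s ^ 2 + X q ^ 2)) p ≤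
      X p / G * gen m X p + 1 / (2 * s) * gen m (fun q => (X q - X p) ^ 2) p := by
    rw [← gen_smul, ← gen_smul, ← gen_add]
    refine gen_le_gen hm.le fun q _ => ?_
    have := sqrt_sq_add_sq_sub_le hs (X p) (X q - X p)
    rw [add_sub_cancel] at this
    refine this.trans (le_of_eq ?_)
    ring
  have hΓ : gen m (fun q => (X q - X p) ^ 2) p ≤ rate n m * (1 + n) ^ 2 * pairCount p.1 := by
    by_cases hp : NoPair p.1
    · have := pairCount_nonneg p.1
      refine (gen_le_rate_mul hm.le le_rfl fun q hq => ?_).trans (b := rate n m * 0) (by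
        rw [mul_zero]; positivity)
      rw [hX, discr_eq_of_noPair m i hp hq, sub_self]
    · have h1 := one_le_pairCount hp
      refine (gen_le_rate_mul hm.le (sq_nonneg (1 + (n : ℝ))) fun q hq => ?_).trans
        (le_mul_of_one_le_right (by positivity) h1)
      rw [sub_self, zero_pow two_ne_zero, sub_zero]
      exact sq_le_sq' (abs_le.1 (abs_discr_sub_le hm i hq)).1
        (abs_le.1 (abs_discr_sub_le hm i hq)).2
  have hdrift : X p / G * gen m X p ≤ rate n m * (1 + n) * tripleCount p.1 := by
    by_cases hp : NoTriple p.1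
    · rw [gen_discr hm i hp, mul_zero]
      have := tripleCount_nonneg p.1
      positivity
    · have h1 := one_le_tripleCount hp
      refine le_trans ?_ (le_mul_of_one_le_right (by positivity) h1)
      have h2 : |gen m X p| ≤ rate n m * (1 + n) :=
        abs_gen_le_rate_mul hm.le (by positivity) fun q hq => abs_discr_sub_le hm i hq
      have h3 : |X p / G| ≤ 1 := by
        rw [abs_div, abs_of_nonneg (Real.sqrt_nonneg _)]
        exact div_le_one_of_le₀ (Real.abs_le_sqrt (by nlinarith [sq_nonneg s]))
          (Real.sqrt_nonneg _)
      refine (le_abs_self _).trans ?_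
      rw [abs_mul]
      exact (mul_le_of_le_one_left (abs_nonneg _) h3).trans h2
  have h5 : 1 / (2 * s) * gen m (fun q => (X q - X p) ^ 2) p ≤
      rate n m * (1 + n) ^ 2 / s * pairCount p.1 := by
    have hP := pairCount_nonneg p.1
    refine (mul_le_mul_of_nonneg_left hΓ (by positivity)).trans ?_
    have h6 : 1 / (2 * s) ≤ 1 / s := one_div_le_one_div_of_le hs (by linarith)
    refine (mul_le_mul_of_nonneg_right h6 (by positivity)).trans (le_of_eq ?_)
    ring
  linarith

theorem sqrt_sqrt_le {x s : ℝ} (hx : 0 ≤ x) (hs : 0 < s) : √√x ≤ x / s ^ 3 + s := by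
  set r := √√x with hr
  have hr0 : 0 ≤ r := Real.sqrt_nonneg _
  have hx4 : x = r ^ 4 := by
    rw [show r ^ 4 = (r ^ 2) ^ 2 by ring, Real.sq_sqrt (Real.sqrt_nonneg _), Real.sq_sqrt hx]
  rcases le_total r s with h | h
  · have : 0 ≤ x / s ^ 3 := by positivity
    linarith
  · have h1 : r ≤ x / s ^ 3 := by
      rw [le_div_iff₀ (by positivity), hx4]
      have := pow_le_pow_left₀ hs.le h 3
      nlinarith
    linarith

theorem abs_le_sq_div_add {z s : ℝ} (hs : 0 < s) : |z| ≤ z ^ 2 / s ^ 2 + s ^ 2 := by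
  have h : z ^ 2 / s ^ 2 = (|z| / s) ^ 2 := by rw [div_pow, sq_abs]
  have h1 : |z| = |z| / s * s := by field_simp
  rw [h]
  nlinarith [sq_nonneg (|z| / s - s), sq_nonneg (|z| / s), sq_nonneg s]

theorem exists_pairCount_lyapunov (n : ℕ) {m : ℝ} (hm : 0 < m) : ∃ c > 0, ∃ V : Conf n → ℝ,
    (∀ y, c * pairCount y ≤ sipGen m V y) ∧ (∀ y, 0 ≤ V y) ∧
    ∀ y, ∀ s : ℝ, 1 ≤ s → V y ≤ (∑ σ : Fin 2 ↪ Fin n, (((y (σ 0) - y (σ 1) : ℤ) : ℝ)) ^ 2) / s ^ 2 +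
      2 * (Fintype.card (Fin 2 ↪ Fin n)) * s ^ 2 := by
  set a := (m + 4) / (2 * (m + 2)) with ha
  have ha0 : 0 ≤ a := by positivity
  have ha1 : a ≤ 1 := by rw [ha, div_le_one (by positivity)]; linarith
  refine ⟨m ^ 2 / (2 * (m + 2)), by positivity,
    fun y => ∑ σ : Fin 2 ↪ Fin n, absPot a ((y ∘ σ) 0 - (y ∘ σ) 1), fun y => ?_, fun y => ?_,
    fun y s hs => ?_⟩
  · rw [sipGen_sum_embedding m (fun u : Conf 2 => absPot a (u 0 - u 1)) y, pairCount,
      Finset.mul_sum]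
    exact Finset.sum_le_sum fun σ _ => sipGen_absPot_ge hm (y ∘ σ)
  · exact Finset.sum_nonneg fun σ _ => add_nonneg (abs_nonneg _) (by positivity)
  · have h : ∀ σ : Fin 2 ↪ Fin n, absPot a ((y ∘ σ) 0 - (y ∘ σ) 1) ≤
        (((y (σ 0) - y (σ 1) : ℤ) : ℝ)) ^ 2 / s ^ 2 + 2 * s ^ 2 := by
      intro σ
      have h1 := abs_le_sq_div_add (z := ((y (σ 0) - y (σ 1) : ℤ) : ℝ)) (s := s) (by linarith)
      have h2 : (if (y ∘ σ) 0 - (y ∘ σ) 1 = 0 then a else 0) ≤ 1 := by split_ifs <;> linarith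
      have h3 : 1 ≤ s ^ 2 := one_le_pow₀ hs
      unfold absPot
      simp only [Function.comp_apply] at *
      linarith
    refine (Finset.sum_le_sum fun σ _ => h σ).trans (le_of_eq ?_)
    rw [Finset.sum_add_distrib, Finset.sum_div, Finset.sum_const, Finset.card_univ, nsmul_eq_mul]
    ring

theorem exists_tripleCount_lyapunov (n : ℕ) {m : ℝ} (hm : 0 < m) :
    ∃ c > 0, ∃ B ≥ 0, ∃ H : Conf n → ℝ,
    (∀ y, c * tripleCount y ≤ sipGen m H y) ∧ (∀ y, 0 ≤ H y) ∧
    ∀ y, ∀ s : ℝ, 1 ≤ s → H y ≤ (∑ σ : Fin 3 ↪ Fin n, triPot (16 / m) (y ∘ σ)) / s ^ 3 + B * s := by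
  obtain ⟨c, hc, h⟩ := exists_le_sipGen_rootPot hm
  have hg : 0 ≤ 16 / m := by positivity
  set K : ℝ := 6400 + 200 * (2 + 2 * (16 / m)) ^ 2 with hK
  have hK0 : 0 ≤ K := by positivity
  refine ⟨c, hc, Fintype.card (Fin 3 ↪ Fin n) * (K + 1), by positivity,
    fun y => ∑ σ : Fin 3 ↪ Fin n, rootPot m (y ∘ σ), fun y => ?_, fun y => ?_, fun y s hs => ?_⟩
  · rw [sipGen_sum_embedding m (rootPot m) y, tripleCount, Finset.mul_sum]
    exact Finset.sum_le_sum fun σ _ => h (y ∘ σ)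
  · exact Finset.sum_nonneg fun σ _ => Real.sqrt_nonneg _
  · have hs0 : 0 < s := by linarith
    have hb : ∀ σ : Fin 3 ↪ Fin n, rootPot m (y ∘ σ) ≤
        triPot (16 / m) (y ∘ σ) / s ^ 3 + (K + 1) * s := by
      intro σ
      have h0 := triPot_nonneg hg (y ∘ σ)
      have h1 := sqrt_sqrt_le (x := K + triPot (16 / m) (y ∘ σ)) (by linarith) hs0
      have h2 : K / s ^ 3 ≤ K := div_le_self hK0 (one_le_pow₀ hs)
      rw [add_div] at h1
      have h3 : K ≤ K * s := le_mul_of_one_le_right hK0 hs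
      change √√(K + triPot (16 / m) (y ∘ σ)) ≤ _
      linarith
    refine (Finset.sum_le_sum fun σ _ => hb σ).trans (le_of_eq ?_)
    rw [Finset.sum_add_distrib, Finset.sum_div, Finset.sum_const, Finset.card_univ, nsmul_eq_mul]
    ring

theorem exists_sipGen_le (n : ℕ) {m : ℝ} (hm : 0 < m) : ∃ C ≥ 0, ∀ y : Conf n,
    sipGen m (fun y => (∑ σ : Fin 2 ↪ Fin n, (((y (σ 0) - y (σ 1) : ℤ) : ℝ)) ^ 2) +
      ∑ σ : Fin 3 ↪ Fin n, triPot (16 / m) (y ∘ σ)) y ≤ C := by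
  refine ⟨Fintype.card (Fin 2 ↪ Fin n) * (2 * m) + Fintype.card (Fin 3 ↪ Fin n) * (6 * m + 42),
    by positivity, fun y => ?_⟩
  have hadd : sipGen m (fun y => (∑ σ : Fin 2 ↪ Fin n, (((y (σ 0) - y (σ 1) : ℤ) : ℝ)) ^ 2) +
      ∑ σ : Fin 3 ↪ Fin n, triPot (16 / m) (y ∘ σ)) y =
      sipGen m (fun y => ∑ σ : Fin 2 ↪ Fin n, ((((y ∘ σ) 0 - (y ∘ σ) 1 : ℤ) : ℝ)) ^ 2) y +
      sipGen m (fun y => ∑ σ : Fin 3 ↪ Fin n, triPot (16 / m) (y ∘ σ)) y := gen_add _ _ _ _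
  rw [hadd, sipGen_sum_embedding m (fun u : Conf 2 => (((u 0 - u 1 : ℤ) : ℝ)) ^ 2) y,
    sipGen_sum_embedding m (triPot (16 / m)) y]
  refine add_le_add ?_ ?_
  · refine (Finset.sum_le_sum fun σ _ => sipGen_sq_le (y ∘ σ) :
      _ ≤ ∑ σ : Fin 2 ↪ Fin n, 2 * m).trans (le_of_eq ?_)
    rw [Finset.sum_const, Finset.card_univ, nsmul_eq_mul]
  · refine (Finset.sum_le_sum fun σ _ => ?_ : _ ≤ ∑ σ : Fin 3 ↪ Fin n, (6 * m + 42)).trans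
      (le_of_eq ?_)
    · rw [sipGen_triPot, mul_div_cancel₀ _ hm.ne']
      have : adjCount (y ∘ σ) ≤ 3 := by
        unfold adjCount
        split_ifs <;> norm_num
      linarith
    · rw [Finset.sum_const, Finset.card_univ, nsmul_eq_mul]

theorem abs_sub_le_abs_discr {n : ℕ} {m : ℝ} (hm : 0 < m) (i : Fin n) (p : Conf n × Conf n) :
    |((p.1 i : ℝ) - p.2 i) - discr m i p| ≤ n := by
  have h : ((p.1 i : ℝ) - p.2 i) - discr m i p =
      1 / (m + 2) * ∑ k, (((p.1 i - p.1 k).sign : ℤ) : ℝ) := by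
    unfold discr; ring
  rw [h, abs_mul, abs_of_pos (by positivity : 0 < 1 / (m + 2))]
  have h1 : |∑ k, (((p.1 i - p.1 k).sign : ℤ) : ℝ)| ≤ n := by
    refine (Finset.abs_sum_le_sum_abs _ _).trans ?_
    refine (Finset.sum_le_sum fun k _ => ?_ : _ ≤ ∑ k : Fin n, (1 : ℝ)).trans (by simp)
    have : |(p.1 i - p.1 k).sign| ≤ 1 := by
      rcases Int.sign_trichotomy (p.1 i - p.1 k) with h | h | h <;> rw [h] <;> norm_num
    exact_mod_cast this
  have h2 : 1 / (m + 2) ≤ 1 := by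
    rw [div_le_one (by positivity)]; linarith
  exact (mul_le_of_le_one_left (abs_nonneg _) h2).trans h1

/-- Started from two equal configurations, the discrepancy at time `s ^ 4` is of order `s`. -/
theorem exists_semigroup_le {n : ℕ} {m : ℝ} (hm : 0 < m) (i : Fin n) : ∃ C : Conf n → ℝ,
    ∀ s : ℝ, 1 ≤ s → ∀ t : ℝ≥0, (t : ℝ) = s ^ 4 → ∀ g : BddFun n,
      (∀ q : Conf n × Conf n, g q ≤ |(q.1 i : ℝ) - q.2 i|) → ∀ y,
        semigroup n m t g (y, y) ≤ C y * s := by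
  obtain ⟨c₁, hc₁, V, hV, hV0, hVle⟩ := exists_pairCount_lyapunov n hm
  obtain ⟨c₂, hc₂, B, hB, H, hH, hH0, hHle⟩ := exists_tripleCount_lyapunov n hm
  obtain ⟨C, hC, hU⟩ := exists_sipGen_le n hm
  set U₂ : Conf n → ℝ := fun y => ∑ σ : Fin 2 ↪ Fin n, (((y (σ 0) - y (σ 1) : ℤ) : ℝ)) ^ 2
    with hU₂
  set U₃ : Conf n → ℝ := fun y => ∑ σ : Fin 3 ↪ Fin n, triPot (16 / m) (y ∘ σ) with hU₃
  have hU₂0 : ∀ y, 0 ≤ U₂ y := fun y => Finset.sum_nonneg fun σ _ => sq_nonneg _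
  have hU₃0 : ∀ y, 0 ≤ U₃ y := fun y =>
    Finset.sum_nonneg fun σ _ => triPot_nonneg (by positivity) _
  have hr := rate_nonneg (n := n) hm.le
  set A₁ := rate n m * (1 + n) ^ 2 / c₁ with hA₁
  set A₂ := rate n m * (1 + n) / c₂ with hA₂
  have hA₁0 : 0 ≤ A₁ := by positivity
  have hA₂0 : 0 ≤ A₂ := by positivity
  set N : ℝ := ((Fintype.card (Fin 2 ↪ Fin n) : ℕ) : ℝ) with hN
  set κ : ℝ := A₁ * (2 * N) + A₂ * B + n with hκ
  refine ⟨fun y => 1 + n + (A₁ + A₂) * (U₂ y + U₃ y) + κ + (A₁ + A₂) * C,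
    fun s hs t ht g hg y => ?_⟩
  have hs0 : 0 < s := by linarith
  have hs3 : 1 ≤ s ^ 3 := one_le_pow₀ hs
  set l := (A₁ + A₂) / s ^ 3 with hl
  have hl0 : 0 ≤ l := by positivity
  let F : Conf n × Conf n → ℝ := fun q => √(s ^ 2 + discr m i q ^ 2) -
    (A₁ / s * V q.1 + A₂ * H q.1) + (l * (U₂ q.1 + U₃ q.1) + κ * s)
  have hF : ∀ q, F q = √(s ^ 2 + discr m i q ^ 2) -
    (A₁ / s * V q.1 + A₂ * H q.1) + (l * (U₂ q.1 + U₃ q.1) + κ * s) := fun _ => rfl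
  have hgen : ∀ q, gen m F q ≤ l * C := by
    intro q
    have e : gen m F q = gen m (fun q => √(s ^ 2 + discr m i q ^ 2)) q -
        (A₁ / s * sipGen m V q.1 + A₂ * sipGen m H q.1) +
        (l * sipGen m (fun y => U₂ y + U₃ y) q.1 + 0) := by
      simp only [F]
      rw [gen_add, gen_sub, gen_add, gen_smul, gen_smul, gen_add, gen_smul, gen_const]
      rfl
    have h1 := gen_sqrt_discr_le hm i hs0 q
    have h2 := mul_le_mul_of_nonneg_left (hV q.1) (by positivity : 0 ≤ A₁ / s)
    have h3 := mul_le_mul_of_nonneg_left (hH q.1) hA₂0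
    have h4 := mul_le_mul_of_nonneg_left (hU q.1) hl0
    have h5 : A₁ / s * (c₁ * pairCount q.1) =
        rate n m * (1 + n) ^ 2 / s * pairCount q.1 := by
      rw [hA₁]; field_simp
    have h6 : A₂ * (c₂ * tripleCount q.1) = rate n m * (1 + n) * tripleCount q.1 := by
      rw [hA₂]; field_simp
    rw [e]
    linarith
  have hlow : ∀ q : Conf n × Conf n, |(q.1 i : ℝ) - q.2 i| ≤ F q := by
    intro q
    have h1 : |discr m i q| ≤ √(s ^ 2 + discr m i q ^ 2) :=
      Real.abs_le_sqrt (by nlinarith [sq_nonneg s])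
    have h2 := abs_sub_le_abs_discr hm i q
    have h3 : |(q.1 i : ℝ) - q.2 i| ≤
        |((q.1 i : ℝ) - q.2 i) - discr m i q| + |discr m i q| := by
      simpa using abs_add_le (((q.1 i : ℝ) - q.2 i) - discr m i q) (discr m i q)
    have h4 := mul_le_mul_of_nonneg_left (hVle q.1 s hs) (by positivity : 0 ≤ A₁ / s)
    have h5 := mul_le_mul_of_nonneg_left (hHle q.1 s hs) hA₂0
    have h6 : A₁ / s * (U₂ q.1 / s ^ 2 + 2 * N * s ^ 2) =
        A₁ / s ^ 3 * U₂ q.1 + A₁ * (2 * N) * s := by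
      field_simp
    have h7 : A₂ * (U₃ q.1 / s ^ 3 + B * s) = A₂ / s ^ 3 * U₃ q.1 + A₂ * B * s := by
      field_simp
    have h8 : l * (U₂ q.1 + U₃ q.1) = A₁ / s ^ 3 * U₂ q.1 + A₂ / s ^ 3 * U₃ q.1 +
        (A₂ / s ^ 3 * U₂ q.1 + A₁ / s ^ 3 * U₃ q.1) := by
      rw [hl]; ring
    have h9 : 0 ≤ A₂ / s ^ 3 * U₂ q.1 := mul_nonneg (by positivity) (hU₂0 _)
    have h10 : 0 ≤ A₁ / s ^ 3 * U₃ q.1 := mul_nonneg (by positivity) (hU₃0 _)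
    have h11 : (n : ℝ) ≤ n * s := le_mul_of_one_le_right (by positivity) hs
    rw [hF, h8, hκ]
    rw [h6] at h4
    rw [h7] at h5
    linarith
  have hmain := semigroup_le_of_gen_le hm.le (mul_nonneg hl0 hC)
    (fun q => (abs_nonneg _).trans (hlow q)) hgen (fun q => (hg q).trans (hlow q)) t (y, y)
  refine hmain.trans ?_
  have h1 : l * C * t = (A₁ + A₂) * C * s := by
    rw [ht, hl]; field_simp
  have h2 : √(s ^ 2 + discr m i (y, y) ^ 2) ≤ s + n := by
    have h3 := abs_sub_le_abs_discr hm i (y, y)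
    simp only [sub_self, zero_sub, abs_neg] at h3
    refine Real.sqrt_le_iff.2 ⟨by positivity, ?_⟩
    have h4 := sq_le_sq' (abs_le.1 h3).1 (abs_le.1 h3).2
    have h5 : 0 ≤ s * n := by positivity
    nlinarith
  have h3 : 0 ≤ A₁ / s * V y + A₂ * H y :=
    add_nonneg (mul_nonneg (by positivity) (hV0 y)) (mul_nonneg hA₂0 (hH0 y))
  have h4 : l * (U₂ y + U₃ y) ≤ (A₁ + A₂) * (U₂ y + U₃ y) * s := by
    have h5 : l ≤ (A₁ + A₂) * s := by
      refine (div_le_self (by positivity) hs3).trans ?_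
      exact le_mul_of_one_le_right (by positivity) hs
    refine (mul_le_mul_of_nonneg_right h5 (add_nonneg (hU₂0 y) (hU₃0 y))).trans (le_of_eq ?_)
    ring
  have h11 : (n : ℝ) ≤ n * s := le_mul_of_one_le_right (by positivity) hs
  rw [hF, h1]
  dsimp only
  linarith

theorem semigroup_le_one {n : ℕ} {m : ℝ} (hm : 0 ≤ m) (t : ℝ≥0) {f : BddFun n}
    (hf : ∀ p, f p ≤ 1) (p : Conf n × Conf n) : semigroup n m t f p ≤ 1 := by
  simpa using semigroup_le_of_gen_le hm (F := fun _ => 1) le_rfl (fun _ => zero_le_one)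
    (fun q => (gen_const m 1 q).le) hf t p

/-- The indicator function of a set of pairs of configurations. -/
noncomputable def indFun {n : ℕ} (s : Set (Conf n × Conf n)) : BddFun n :=
  ⟨s.indicator 1, memℓp_infty ⟨1, by
    rintro _ ⟨p, rfl⟩
    by_cases h : p ∈ s <;> simp [h]⟩⟩

theorem indFun_apply {n : ℕ} (s : Set (Conf n × Conf n)) (p : Conf n × Conf n) :
    indFun s p = s.indicator 1 p := rfl

theorem indFun_nonneg {n : ℕ} (s : Set (Conf n × Conf n)) (p : Conf n × Conf n) :
    0 ≤ indFun s p := Set.indicator_nonneg (fun _ _ => zero_le_one) p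

theorem indFun_le_one {n : ℕ} (s : Set (Conf n × Conf n)) (p : Conf n × Conf n) :
    indFun s p ≤ 1 := Set.indicator_le_self' (fun _ _ => zero_le_one) p

theorem IsCoupling.measureReal_eq {Ω : Type*} [MeasurableSpace Ω] {μ : Measure Ω}
    [IsProbabilityMeasure μ] {n : ℕ} {m : ℝ} {Y Y' : ℝ≥0 → Ω → Conf n}
    (h : IsCoupling μ m Y Y') (t : ℝ≥0) (s : Set (Conf n × Conf n)) :
    μ.real {ω | (Y t ω, Y' t ω) ∈ s} = ∫ ω, semigroup n m t (indFun s) (Y 0 ω, Y' 0 ω) ∂μ := by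
  have hmeas : ∀ r, Measurable fun ω => (Y r ω, Y' r ω) := fun r =>
    (h.measurable_left r).prodMk (h.measurable_right r)
  have hle : ⨆ r ≤ (0 : ℝ≥0), MeasurableSpace.comap (fun ω => (Y r ω, Y' r ω)) inferInstance ≤
      (inferInstance : MeasurableSpace Ω) := iSup₂_le fun r _ => (hmeas r).comap_le
  have h1 := integral_congr_ae (h.markov 0 t (indFun s))
  rw [integral_condExp hle] at h1
  rw [← h1]
  have hs : MeasurableSet {ω | (Y t ω, Y' t ω) ∈ s} := hmeas t (Set.to_countable s).measurableSet
  rw [← integral_indicator_one hs]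
  refine integral_congr_ae (ae_of_all _ fun ω => ?_)
  simp only [zero_add, indFun_apply]
  rfl

theorem IsCoupling.tendstoInMeasure {Ω : Type*} [MeasurableSpace Ω] {μ : Measure Ω} [IsProbabilityMeasure μ]
    {n : ℕ} {m : ℝ} (hm : 0 < m) {Y Y' : ℝ≥0 → Ω → Conf n}
    (hcoupling : IsCoupling μ m Y Y')
    (hstart : ∀ᵐ ω ∂μ, Y 0 ω = Y' 0 ω) (i : Fin n) :
    TendstoInMeasure μ
      (fun (t : ℝ≥0) ω => |(Y t ω i : ℝ) - (Y' t ω i : ℝ)| ^ 2 / (t : ℝ))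
      atTop (fun _ => 0) := by
  rw [tendstoInMeasure_iff_measureReal_norm]
  intro ε hε
  let E : ℝ≥0 → Set (Conf n × Conf n) := fun t =>
    {q | ε ≤ ‖|(q.1 i : ℝ) - (q.2 i : ℝ)| ^ 2 / (t : ℝ) - 0‖}
  have hE : ∀ t : ℝ≥0, μ.real {ω | ε ≤ ‖|(Y t ω i : ℝ) - (Y' t ω i : ℝ)| ^ 2 / (t : ℝ) - 0‖} =
      ∫ ω, semigroup n m t (indFun (E t)) (Y 0 ω, Y' 0 ω) ∂μ :=
    fun t => hcoupling.measureReal_eq t (E t)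
  simp only [hE]
  obtain ⟨C, hC⟩ := exists_semigroup_le hm i
  have hbound : ∀ y : Conf n, ∀ t : ℝ≥0, 1 ≤ (t : ℝ) →
      semigroup n m t (indFun (E t)) (y, y) ≤ C y / √ε / √√(t : ℝ) := by
    intro y t ht
    have ht0 : (0 : ℝ) < t := by linarith
    set s := √√(t : ℝ) with hs
    have hs1 : 1 ≤ s := Real.le_sqrt_of_sq_le (Real.le_sqrt_of_sq_le (by simpa using ht))
    have hs2 : s ^ 2 = √(t : ℝ) := Real.sq_sqrt (Real.sqrt_nonneg _)
    have hs4 : (t : ℝ) = s ^ 4 := by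
      rw [show s ^ 4 = (s ^ 2) ^ 2 by ring, hs2, Real.sq_sqrt ht0.le]
    have hs0 : 0 < s := by linarith
    have hε0 : 0 < √ε := Real.sqrt_pos.2 hε
    have h := hC s hs1 t hs4 ((√ε * s ^ 2) • indFun (E t)) (fun q => by
      change √ε * s ^ 2 * indFun (E t) q ≤ _
      rw [indFun_apply]
      by_cases hq : q ∈ E t
      · rw [Set.indicator_of_mem hq, Pi.one_apply, mul_one]
        have hq' : ε ≤ ‖|(q.1 i : ℝ) - (q.2 i : ℝ)| ^ 2 / (t : ℝ) - 0‖ := hq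
        rw [sub_zero, Real.norm_of_nonneg (by positivity), le_div_iff₀ ht0] at hq'
        refine abs_le_of_sq_le_sq' ?_ (abs_nonneg _) |>.2
        rw [mul_pow, Real.sq_sqrt hε.le, ← pow_mul, ← hs4]
        exact hq'
      · rw [Set.indicator_of_notMem hq, mul_zero]
        exact abs_nonneg _) y
    rw [map_smul] at h
    replace h : √ε * s ^ 2 * semigroup n m t (indFun (E t)) (y, y) ≤ C y * s := h
    rw [div_div, le_div_iff₀ (by positivity)]
    have h' : s * (semigroup n m t (indFun (E t)) (y, y) * (√ε * s)) ≤ s * C y := by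
      linarith
    exact le_of_mul_le_mul_left h' hs0
  have hlim : ∀ y : Conf n,
      Tendsto (fun t : ℝ≥0 => semigroup n m t (indFun (E t)) (y, y)) atTop (𝓝 0) := by
    intro y
    have hroot : Tendsto (fun t : ℝ≥0 => √√(t : ℝ)) atTop atTop :=
      Real.tendsto_sqrt_atTop.comp (Real.tendsto_sqrt_atTop.comp
        (NNReal.tendsto_coe_atTop.2 tendsto_id))
    refine squeeze_zero' (Eventually.of_forall fun t => semigroup_nonneg hm.le t
      (indFun_nonneg _) _) ?_ (hroot.const_div_atTop (C y / √ε))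
    filter_upwards [eventually_ge_atTop (1 : ℝ≥0)] with t ht
    exact hbound y t (by exact_mod_cast ht)
  have hdct := tendsto_integral_filter_of_dominated_convergence (μ := μ) (l := atTop)
    (F := fun (t : ℝ≥0) ω => semigroup n m t (indFun (E t)) (Y 0 ω, Y' 0 ω))
    (f := fun _ => (0 : ℝ)) (fun _ => 1)
    (Eventually.of_forall fun t => by
      have h1 : Measurable fun q : Conf n × Conf n => semigroup n m t (indFun (E t)) q :=
        measurable_of_countable _
      exact (h1.comp ((hcoupling.measurable_left 0).prodMk
        (hcoupling.measurable_right 0))).aestronglyMeasurable)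
    (Eventually.of_forall fun t => ae_of_all _ fun ω => by
      rw [Real.norm_of_nonneg (semigroup_nonneg hm.le t (indFun_nonneg _) _)]
      exact semigroup_le_one hm.le t (indFun_le_one _) _)
    (integrable_const _)
    (by
      filter_upwards [hstart] with ω hω
      rw [← hω]
      exact hlim (Y 0 ω))
  simpa using hdct

end InclusionProcess

theorem theorem3p2 {Ω : Type*} [MeasurableSpace Ω] (μ : Measure Ω) [IsProbabilityMeasure μ]
    (n : ℕ) (m : ℝ) (hm : 0 < m) (Y Y' : ℝ≥0 → Ω → InclusionProcess.Conf n)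
    (hcoupling : InclusionProcess.IsCoupling μ m Y Y')
    (hstart : ∀ᵐ ω ∂μ, Y 0 ω = Y' 0 ω) (i : Fin n) :
    TendstoInMeasure μ
      (fun (t : ℝ≥0) ω => |(Y t ω i : ℝ) - (Y' t ω i : ℝ)| ^ 2 / (t : ℝ))
      atTop (fun _ => 0) :=
  hcoupling.tendstoInMeasure hm hstart i
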